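/- Let $q\in\mathbb C$, $q\neq 0$, and let $B=B(R)$ be the algebra satisfied by the entries of the braided matrix $BSL_q(2)$: the unital associative $\mathbb C$-algebra generated by $a,b,c,d$ with relations $$ba=q^2ab,\quad ca=q^{-2}ac,\quad ad=da,\quad bc=cb+(1-q^{-2})a(d-a),$$ $$db=bd+(1-q^{-2})ab,\quad cd=dc+(1-q^{-2})ca,\quad ad-q^2cb=1.$$ A braided Hopf algebra structure on a unital associative algebra $B$ with product $m$ and unit $\eta$ consists of linear maps $\Delta:B\to B\otimes B$, $\varepsilon:B\to\mathbb C$, $S:B\to B$ and an invertible linear map $\psi:B\otimes B\to B\otimes B$ such that $\Delta$ is coassociative with counit $\varepsilon$ and $$m(\mathrm{id}\otimes S)\Delta=m(S\otimes \mathrm{id})\Delta=\eta\varepsilon,\qquad (\psi\otimes \mathrm{id})(\mathrm{id}\otimes\psi)(\psi\otimes \mathrm{id})=(\mathrm{id}\otimes\psi)(\psi\otimes \mathrm{id})(\mathrm{id}\otimes\psi),$$ $$\psi(m\otimes \mathrm{id})=(\mathrm{id}\otimes m)(\psi\otimes \mathrm{id})(\mathrm{id}\otimes\psi),\qquad \psi(\mathrm{id}\otimes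 m)=(m\otimes \mathrm{id})(\mathrm{id}\otimes\psi)(\psi\otimes \mathrm{id}),$$ $$(\mathrm{id}\otimes\Delta)\psi=(\psi\otimes \mathrm{id})(\mathrm{id}\otimes\psi)(\Delta\otimes \mathrm{id}),\qquad (\Delta\otimes \mathrm{id})\psi=(\mathrm{id}\otimes\psi)(\psi\otimes \mathrm{id})(\mathrm{id}\otimes\Delta),$$ $$\Delta m=(m\otimes m)(\mathrm{id}\otimes\psi\otimes \mathrm{id})(\Delta\otimes\Delta),\quad \varepsilon m=\varepsilon\otimes\varepsilon,\quad Sm=m\psi(S\otimes S),\quad \Delta S=(S\otimes S)\psi\Delta,$$ together with $\Delta(1)=1\otimes1$, $\varepsilon(1)=1$, $\psi(1\otimes x)=x\otimes 1$, $\psi(x\otimes 1)=1\otimes x$ for all $x\in B$, and the compatibility of $\psi$ with $\varepsilon$ and $S$: $(\mathrm{id}\otimes\varepsilon)\psi=\varepsilon\otimes \mathrm{id}$, $(\varepsilon\otimes \mathrm{id})\psi=\mathrm{id}\otimes\varepsilon$, $\psi(S\otimes \mathrm{id})=(\mathrm{id}\otimes S)\psi$, $\psi(\mathrm{id}\otimes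 S)=(S\otimes \mathrm{id})\psi$. Then $B$ carries a braided Hopf algebra structure with coproduct $$\Delta(a)=a\otimes a+q^4c\otimes b,\qquad \Delta(b)=(1-q^2)a\otimes b+b\otimes a+q^2d\otimes b,$$ $$\Delta(c)=(1-q^2)c\otimes a+a\otimes c+q^2c\otimes d,$$ $$\Delta(d)=(q^2-1)a\otimes a+(q^4-q^2)c\otimes b+q^2b\otimes c+(1-q^2)a\otimes d+(1-q^2)d\otimes a+q^2d\otimes d,$$ counit $\varepsilon(a)=\varepsilon(d)=1$, $\varepsilon(b)=\varepsilon(c)=0$, antipode $$S(a)=d,\quad S(b)=-q^{-2}b,\quad S(c)=-q^{-2}c,\quad S(d)=q^{-2}a+(1-q^{-2})d,$$ and braiding $$\begin{aligned} \psi(a\otimes a)&=a\otimes a+(q^4-q^2)c\otimes b, & \psi(a\otimes b)&=b\otimes a+(1-q^2)a\otimes b+(q^2-1)d\otimes b,\\ \psi(a\otimes c)&=c\otimes a, & \psi(a\otimes d)&=d\otimes a+(1-q^2)c\otimes b,\\ \psi(b\otimes a)&=a\otimes b, & \psi(b\otimes b)&=q^{-2}b\otimes b,\\ \psi(b\otimes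 c)&=q^2c\otimes b, & \psi(b\otimes d)&=d\otimes b,\\ \psi(c\otimes a)&=a\otimes c+(1-q^2)c\otimes a+(q^2-1)c\otimes d, & \psi(c\otimes c)&=q^{-2}c\otimes c,\\ \psi(c\otimes d)&=d\otimes c+(1-q^{-2})c\otimes a+(q^{-2}-1)c\otimes d, & \psi(d\otimes a)&=a\otimes d+(1-q^2)c\otimes b,\\ \psi(d\otimes b)&=b\otimes d+(1-q^{-2})a\otimes b+(q^{-2}-1)d\otimes b, & \psi(d\otimes c)&=c\otimes d,\\ \psi(d\otimes d)&=d\otimes d+(1-q^{-2})c\otimes b, \end{aligned}$$ $$\psi(c\otimes b)=(q^2-1)a\otimes a+q^2b\otimes c+(q^4-q^2+q^{-2}-1)c\otimes b+(1-q^2)a\otimes d+(1-q^2)d\otimes a+(q^2-1)d\otimes d.$$ If $q$ is real, this is a braided Hopf $*$-algebra: there is an antilinear, antimultiplicative involution $*$ on $B$ with $a^*=a$, $b^*=c$, $c^*=b$, $d^*=d$ such that, with $(x\otimes y)^*=y^*\otimes x^*$ on $B\otimes B$, one has $\Delta(x^*)=\Delta(x)^*$, $S(x^*)=S(x)^*$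 for all $x\in B$ and $\psi(u^*)=\psi(u)^*$ for all $u\in B\otimes B$. The structure is different from Majid's, for which $\Delta(a)=a\otimes a+b\otimes c$ and $\psi(a\otimes a)=a\otimes a+(1-q^2)b\otimes c$: here $\Delta(a)\neq a\otimes a+b\otimes c$ for every $q\ne0$, and $\psi(a\otimes a)\neq a\otimes a+(1-q^2)b\otimes c$ whenever $q^2\neq1$. -/

import Mathlib

open scoped TensorProduct

noncomputable section

namespace BraidedLegs

variable (R : Type*) {A : Type*} [CommRing R] [Ring A] [Algebra R A]

/-- A two-leg operator applied to the first two of three legs. -/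
def leg12 {M : Type*} [AddCommGroup M] [Module R M]
    (ψ : A ⊗[R] A →ₗ[R] A ⊗[R] A) : A ⊗[R] (A ⊗[R] M) →ₗ[R] A ⊗[R] (A ⊗[R] M) :=
  (TensorProduct.assoc R A A M).toLinearMap ∘ₗ ψ.rTensor M ∘ₗ
    (TensorProduct.assoc R A A M).symm.toLinearMap

/-- A two-leg operator applied to the last two of three legs. -/
def leg23 (ψ : A ⊗[R] A →ₗ[R] A ⊗[R] A) : A ⊗[R] (A ⊗[R] A) →ₗ[R] A ⊗[R] (A ⊗[R] A) :=
  ψ.lTensor A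

variable (A) in
/-- `m ⊗ id`. -/
def mul12 : A ⊗[R] (A ⊗[R] A) →ₗ[R] A ⊗[R] A :=
  (LinearMap.mul' R A).rTensor A ∘ₗ (TensorProduct.assoc R A A A).symm.toLinearMap

variable (A) in
/-- `id ⊗ m`. -/
def mul23 : A ⊗[R] (A ⊗[R] A) →ₗ[R] A ⊗[R] A :=
  (LinearMap.mul' R A).lTensor A

/-- `Δ ⊗ id`. -/
def comul1 (Δ : A →ₗ[R] A ⊗[R] A) : A ⊗[R] A →ₗ[R] A ⊗[R] (A ⊗[R] A) :=
  (TensorProduct.assoc R A A A).toLinearMap ∘ₗ Δ.rTensor A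

/-- `id ⊗ Δ`. -/
def comul2 (Δ : A →ₗ[R] A ⊗[R] A) : A ⊗[R] A →ₗ[R] A ⊗[R] (A ⊗[R] A) :=
  Δ.lTensor A

/-- The multiplication `(m ⊗ m) ∘ (id ⊗ ψ ⊗ id)` of the braided tensor product of `A` with
itself, that is `(x ⊗ y)(w ⊗ z) = x ψ(y ⊗ w) z`. -/
def braidedMul (ψ : A ⊗[R] A →ₗ[R] A ⊗[R] A) : (A ⊗[R] A) ⊗[R] (A ⊗[R] A) →ₗ[R] A ⊗[R] A :=
  TensorProduct.map (LinearMap.mul' R A) (LinearMap.mul' R A) ∘ₗ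
    (TensorProduct.assoc R A A (A ⊗[R] A)).symm.toLinearMap ∘ₗ
      (leg12 R ψ).lTensor A ∘ₗ (TensorProduct.assoc R A A (A ⊗[R] A)).toLinearMap

end BraidedLegs

open BraidedLegs

/-- A braided Hopf algebra structure on an associative unital `R`-algebra `A`: a coalgebra
structure (`Δ = comul`, `ε = counit`), an antipode `S` and a braiding `ψ`. -/
structure BraidedHopfAlgebra (R A : Type*) [CommRing R] [Ring A] [Algebra R A] extends
    Coalgebra R A where
  /-- the antipode -/
  S : A →ₗ[R] A
  /-- the braiding -/
  ψ : A ⊗[R] A →ₗ[R] A ⊗[R] A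
  /-- the braiding is invertible -/
  ψ_bijective : Function.Bijective ψ
  /-- the Yang-Baxter equation -/
  yang_baxter : leg12 R ψ ∘ₗ leg23 R ψ ∘ₗ leg12 R ψ = leg23 R ψ ∘ₗ leg12 R ψ ∘ₗ leg23 R ψ
  /-- `ψ ∘ (m ⊗ id) = (id ⊗ m) ∘ (ψ ⊗ id) ∘ (id ⊗ ψ)` -/
  ψ_mul_left : ψ ∘ₗ mul12 R A = mul23 R A ∘ₗ leg12 R ψ ∘ₗ leg23 R ψ
  /-- `ψ ∘ (id ⊗ m) = (m ⊗ id) ∘ (id ⊗ ψ) ∘ (ψ ⊗ id)` -/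
  ψ_mul_right : ψ ∘ₗ mul23 R A = mul12 R A ∘ₗ leg23 R ψ ∘ₗ leg12 R ψ
  ψ_one_left : ∀ x : A, ψ (1 ⊗ₜ[R] x) = x ⊗ₜ[R] 1
  ψ_one_right : ∀ x : A, ψ (x ⊗ₜ[R] 1) = 1 ⊗ₜ[R] x
  /-- `(id ⊗ Δ) ∘ ψ = (ψ ⊗ id) ∘ (id ⊗ ψ) ∘ (Δ ⊗ id)` -/
  ψ_comul_left : comul2 R comul ∘ₗ ψ = leg12 R ψ ∘ₗ leg23 R ψ ∘ₗ comul1 R comul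
  /-- `(Δ ⊗ id) ∘ ψ = (id ⊗ ψ) ∘ (ψ ⊗ id) ∘ (id ⊗ Δ)` -/
  ψ_comul_right : comul1 R comul ∘ₗ ψ = leg23 R ψ ∘ₗ leg12 R ψ ∘ₗ comul2 R comul
  ψ_counit_left : counit.lTensor A ∘ₗ ψ = (TensorProduct.comm R R A).toLinearMap ∘ₗ
    counit.rTensor A
  ψ_counit_right : counit.rTensor A ∘ₗ ψ = (TensorProduct.comm R A R).toLinearMap ∘ₗ
    counit.lTensor A
  ψ_antipode_left : ψ ∘ₗ S.rTensor A = S.lTensor A ∘ₗ ψ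
  ψ_antipode_right : ψ ∘ₗ S.lTensor A = S.rTensor A ∘ₗ ψ
  /-- `Δ` is multiplicative for the braided tensor product:
  `Δ ∘ m = (m ⊗ m) ∘ (id ⊗ ψ ⊗ id) ∘ (Δ ⊗ Δ)` -/
  comul_mul : comul ∘ₗ LinearMap.mul' R A = braidedMul R ψ ∘ₗ TensorProduct.map comul comul
  comul_one : comul 1 = 1 ⊗ₜ[R] 1
  counit_mul : ∀ x y : A, counit (x * y) = counit x * counit y
  counit_one : counit 1 = 1
  /-- `m ∘ (S ⊗ id) ∘ Δ = η ∘ ε` -/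
  antipode_left : LinearMap.mul' R A ∘ₗ S.rTensor A ∘ₗ comul = Algebra.linearMap R A ∘ₗ counit
  /-- `m ∘ (id ⊗ S) ∘ Δ = η ∘ ε` -/
  antipode_right : LinearMap.mul' R A ∘ₗ S.lTensor A ∘ₗ comul = Algebra.linearMap R A ∘ₗ counit
  /-- `S ∘ m = m ∘ ψ ∘ (S ⊗ S)` -/
  antipode_mul : S ∘ₗ LinearMap.mul' R A = LinearMap.mul' R A ∘ₗ ψ ∘ₗ TensorProduct.map S S
  /-- `Δ ∘ S = (S ⊗ S) ∘ ψ ∘ Δ` -/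
  comul_antipode : comul ∘ₗ S = TensorProduct.map S S ∘ₗ ψ ∘ₗ comul

/-- The involution `(x ⊗ y)* = y* ⊗ x*` on a braided tensor square, as an antilinear map. -/
def tensorInvol {A : Type*} [Ring A] [Algebra ℂ A] (st : A →ₛₗ[starRingEnd ℂ] A) :
    A ⊗[ℂ] A →ₛₗ[starRingEnd ℂ] A ⊗[ℂ] A :=
  (TensorProduct.comm ℂ A A).toLinearMap ∘ₛₗ TensorProduct.map st st

/-- `st` is an involution making the braided Hopf algebra `H` a braided Hopf `*`-algebra.
The last condition says that `(x ⊗ y)* = y* ⊗ x*` respects the braiding; equivalently, that it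
makes the braided tensor square a `*`-algebra. -/
structure IsBraidedInvolution {A : Type*} [Ring A] [Algebra ℂ A] (H : BraidedHopfAlgebra ℂ A)
    (st : A →ₛₗ[starRingEnd ℂ] A) : Prop where
  invol : ∀ x, st (st x) = x
  antimul : ∀ x y, st (x * y) = st y * st x
  comul_star : ∀ x, H.comul (st x) = tensorInvol st (H.comul x)
  antipode_star : ∀ x, H.S (st x) = st (H.S x)
  ψ_star : ∀ u, H.ψ (tensorInvol st u) = tensorInvol st (H.ψ u)

namespace BSL

/-- The four generators, the entries of the braided matrix. -/
inductive Gen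
  | a | b | c | d

/-- The free algebra generator attached to `g`. -/
abbrev gen (g : Gen) : FreeAlgebra ℂ Gen := FreeAlgebra.ι ℂ g

open Gen in
/-- The defining relations of the algebra of the braided matrix `BSL_q(2)`. -/
inductive Rel (q : ℂ) : FreeAlgebra ℂ Gen → FreeAlgebra ℂ Gen → Prop
  | ba : Rel q (gen b * gen a) (q ^ 2 • (gen a * gen b))
  | ca : Rel q (gen c * gen a) ((q ^ 2)⁻¹ • (gen a * gen c))
  | ad : Rel q (gen a * gen d) (gen d * gen a)
  | bc : Rel q (gen b * gen c)
      (gen c * gen b + (1 - (q ^ 2)⁻¹) • (gen a * (gen d - gen a)))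
  | db : Rel q (gen d * gen b) (gen b * gen d + (1 - (q ^ 2)⁻¹) • (gen a * gen b))
  | cd : Rel q (gen c * gen d) (gen d * gen c + (1 - (q ^ 2)⁻¹) • (gen c * gen a))
  | det : Rel q (gen a * gen d - q ^ 2 • (gen c * gen b)) 1

/-- The braided algebra `B(R)`: the unital associative `ℂ`-algebra generated by `a, b, c, d`
subject to the relations above. -/
abbrev B (q : ℂ) : Type := RingQuot (Rel q)

variable (q : ℂ)

/-- The image of a generator in `B(R)`. -/
def of (g : Gen) : B q := RingQuot.mkAlgHom ℂ (Rel q) (gen g)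

def a : B q := of q Gen.a
def b : B q := of q Gen.b
def c : B q := of q Gen.c
def d : B q := of q Gen.d

/-- The coproduct on generators. -/
structure CoproductValues (Δ : B q →ₗ[ℂ] B q ⊗[ℂ] B q) : Prop where
  Δa : Δ (a q) = a q ⊗ₜ a q + q ^ 4 • (c q ⊗ₜ b q)
  Δb : Δ (b q) = (1 - q ^ 2) • (a q ⊗ₜ b q) + b q ⊗ₜ a q + q ^ 2 • (d q ⊗ₜ b q)
  Δc : Δ (c q) = (1 - q ^ 2) • (c q ⊗ₜ a q) + a q ⊗ₜ c q + q ^ 2 • (c q ⊗ₜ d q)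
  Δd : Δ (d q) = (q ^ 2 - 1) • (a q ⊗ₜ a q) + (q ^ 4 - q ^ 2) • (c q ⊗ₜ b q)
    + q ^ 2 • (b q ⊗ₜ c q) + (1 - q ^ 2) • (a q ⊗ₜ d q) + (1 - q ^ 2) • (d q ⊗ₜ a q)
    + q ^ 2 • (d q ⊗ₜ d q)

/-- The counit on generators. -/
structure CounitValues (ε : B q →ₗ[ℂ] ℂ) : Prop where
  εa : ε (a q) = 1
  εb : ε (b q) = 0
  εc : ε (c q) = 0
  εd : ε (d q) = 1

/-- The antipode on generators. -/
structure AntipodeValues (S : B q →ₗ[ℂ] B q) : Prop where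
  Sa : S (a q) = d q
  Sb : S (b q) = -((q ^ 2)⁻¹ • b q)
  Sc : S (c q) = -((q ^ 2)⁻¹ • c q)
  Sd : S (d q) = (q ^ 2)⁻¹ • a q + (1 - (q ^ 2)⁻¹) • d q

/-- The braiding on pairs of generators. -/
structure BraidingValues (ψ : B q ⊗[ℂ] B q →ₗ[ℂ] B q ⊗[ℂ] B q) : Prop where
  aa : ψ (a q ⊗ₜ a q) = a q ⊗ₜ a q + (q ^ 4 - q ^ 2) • (c q ⊗ₜ b q)
  ab : ψ (a q ⊗ₜ b q) = b q ⊗ₜ a q + (1 - q ^ 2) • (a q ⊗ₜ b q) + (q ^ 2 - 1) • (d q ⊗ₜ b q)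
  ac : ψ (a q ⊗ₜ c q) = c q ⊗ₜ a q
  ad : ψ (a q ⊗ₜ d q) = d q ⊗ₜ a q + (1 - q ^ 2) • (c q ⊗ₜ b q)
  ba : ψ (b q ⊗ₜ a q) = a q ⊗ₜ b q
  bb : ψ (b q ⊗ₜ b q) = (q ^ 2)⁻¹ • (b q ⊗ₜ b q)
  bc : ψ (b q ⊗ₜ c q) = q ^ 2 • (c q ⊗ₜ b q)
  bd : ψ (b q ⊗ₜ d q) = d q ⊗ₜ b q
  ca : ψ (c q ⊗ₜ a q) = a q ⊗ₜ c q + (1 - q ^ 2) • (c q ⊗ₜ a q) + (q ^ 2 - 1) • (c q ⊗ₜ d q)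
  cb : ψ (c q ⊗ₜ b q) = (q ^ 2 - 1) • (a q ⊗ₜ a q) + q ^ 2 • (b q ⊗ₜ c q)
    + (q ^ 4 - q ^ 2 + (q ^ 2)⁻¹ - 1) • (c q ⊗ₜ b q) + (1 - q ^ 2) • (a q ⊗ₜ d q)
    + (1 - q ^ 2) • (d q ⊗ₜ a q) + (q ^ 2 - 1) • (d q ⊗ₜ d q)
  cc : ψ (c q ⊗ₜ c q) = (q ^ 2)⁻¹ • (c q ⊗ₜ c q)
  cd : ψ (c q ⊗ₜ d q) = d q ⊗ₜ c q + (1 - (q ^ 2)⁻¹) • (c q ⊗ₜ a q)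
    + ((q ^ 2)⁻¹ - 1) • (c q ⊗ₜ d q)
  da : ψ (d q ⊗ₜ a q) = a q ⊗ₜ d q + (1 - q ^ 2) • (c q ⊗ₜ b q)
  db : ψ (d q ⊗ₜ b q) = b q ⊗ₜ d q + (1 - (q ^ 2)⁻¹) • (a q ⊗ₜ b q)
    + ((q ^ 2)⁻¹ - 1) • (d q ⊗ₜ b q)
  dc : ψ (d q ⊗ₜ c q) = c q ⊗ₜ d q
  dd : ψ (d q ⊗ₜ d q) = d q ⊗ₜ d q + (1 - (q ^ 2)⁻¹) • (c q ⊗ₜ b q)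

/-- The involution on generators. -/
structure InvolutionValues (st : B q →ₛₗ[starRingEnd ℂ] B q) : Prop where
  star_a : st (a q) = a q
  star_b : st (b q) = c q
  star_c : st (c q) = b q
  star_d : st (d q) = d q

end BSL

end

/-!
Write `B` for the algebra, `Alg q`. The whole structure comes from one action and one coaction.
The algebra `B` carries an automorphism `κ`, rescaling `b` and `c`, and a skew derivation `X`, with
`X (x y) = x X(y) + X(x) κ(y)` and `κ X = q² X κ`. These operators are an action on `B` of a Borel
Hopf algebra `H`, with generators `k`, `k⁻¹`, `x`, where `k` is group-like and
`Δ x = 1 ⊗ x + x ⊗ k`. On the other hand `B` is an `H`-comodule algebra through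
`a ↦ 1 ⊗ a + x ⊗ b`, `b ↦ k ⊗ b`, `d ↦ 1 ⊗ d - q⁻² x ⊗ b`,
`c ↦ k⁻¹ ⊗ c + k⁻¹ x ⊗ (d - a) - k⁻¹ x² ⊗ b`. The braiding is
`ψ (x ⊗ y) = x₍₋₁₎ · y ⊗ x₍₀₎`, the braiding of Yetter–Drinfeld modules over `H`. Neither `H` nor
its representation theory is needed: an action is a triple of operators (`BorelAction`), and `pass`
is the operator by which a generator of `B`, through its coaction, crosses a module `M` and then
acts on a second factor `N`. Acting on `B ⊗ B` by `pass` respects the relations of `B`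
(`pass_isBSL`), which gives an algebra map `L : B → End (B ⊗ B)` with `ψ (x ⊗ y) = L x (y ⊗ 1)`.

Almost every identity of the theorem is then proved by induction on a left factor, one generator at
a time. The hexagon `ψ (m ⊗ id)` is multiplicativity of `L`, and the other one holds because `L x`
commutes with right multiplication in the braided square. An operator that commutes with `κ` and
`X` commutes with `pass` (`IsBorelHom.pass_map`). As `ψ`, `Δ` and `S` do
(`isBorelHom_ψ`, `isBorelHom_comul`, `isBorelHom_S`), this and
coassociativity of the coaction (`pass_pass`) give the Yang–Baxter equation and the compatibility of
`ψ` with `Δ` and with `S`. The inverse of `ψ` is built in the same way from operators that let a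
generator cross from right to left.

The coproduct must be multiplicative for the product `(x ⊗ y)(w ⊗ z) = x ψ(y ⊗ w) z` on `B ⊗ B`.
Its left multiplications are `μ (x ⊗ y) = (x ⊗ 1) L(y)`, and `μ_mul_μ` is associativity. Hence `Δ`
exists as soon as the prescribed values satisfy the relations of `B` there (`comulGen_isBSL`).
In the same way `S` comes from the associative product `m ψ` on `B` (`C_mul_C`,
`antipode_isBSL`). Finally `Δ ∘ S` and `(S ⊗ S) ψ Δ` are a right and a left convolution inverse of
`Δ`, so they agree (`comul_antipode`).

For real `q` the relations are symmetric under the antilinear anti-automorphism exchanging `b` and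
`c`. Conjugating `ψ` by the involution exchanges the two hexagons, so that it suffices to compare
`ψ` with its conjugate on pairs of generators (`ψ_tensorInvol`). The two inequalities are detected
by pairs of characters of `B` that vanish on `a` and `d`.
-/

noncomputable section

open BraidedLegs

set_option linter.unusedSectionVars false

namespace BSL

/-! ### The algebra and its universal property -/

/-- The algebra `B q`. It is a new type so that instance search sees only the ring and algebra
structures below, instead of unfolding `RingQuot`. -/
def Alg (q : ℂ) : Type := B q

instance (q : ℂ) : Ring (Alg q) := inferInstanceAs (Ring (B q))
instance (q : ℂ) : Algebra ℂ (Alg q) := inferInstanceAs (Algebra ℂ (B q))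

namespace Alg

section presentation

/-- The quotient map from the free algebra. -/
def mk (q : ℂ) : FreeAlgebra ℂ Gen →ₐ[ℂ] Alg q := RingQuot.mkAlgHom ℂ (Rel q)

theorem mk_surjective (q : ℂ) : Function.Surjective (mk q) :=
  RingQuot.mkAlgHom_surjective ℂ (Rel q)

/-- The image of a generator in `Alg q`. -/
def of (q : ℂ) (g : Gen) : Alg q := mk q (gen g)

def a (q : ℂ) : Alg q := of q .a
def b (q : ℂ) : Alg q := of q .b
def c (q : ℂ) : Alg q := of q .c
def d (q : ℂ) : Alg q := of q .d

/-- The defining relations of `Alg q`, for four elements of an arbitrary algebra. -/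
structure IsBSL (q : ℂ) {A : Type*} [Ring A] [Algebra ℂ A] (a b c d : A) : Prop where
  ba : b * a = q ^ 2 • (a * b)
  ca : c * a = (q ^ 2)⁻¹ • (a * c)
  ad : a * d = d * a
  bc : b * c = c * b + (1 - (q ^ 2)⁻¹) • (a * (d - a))
  db : d * b = b * d + (1 - (q ^ 2)⁻¹) • (a * b)
  cd : c * d = d * c + (1 - (q ^ 2)⁻¹) • (c * a)
  det : a * d - q ^ 2 • (c * b) = 1

section lift

variable {q : ℂ} {A : Type*} [Ring A] [Algebra ℂ A] {α β γ δ : A}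

/-- The universal property: four elements that satisfy the relations define an algebra map. -/
def lift (h : IsBSL q α β γ δ) : Alg q →ₐ[ℂ] A :=
  RingQuot.liftAlgHom ℂ ⟨FreeAlgebra.lift ℂ fun | .a => α | .b => β | .c => γ | .d => δ, by
    rintro _ _ (_ | _ | _ | _ | _ | _ | _) <;> simp [h.ba, h.ca, h.ad, h.bc, h.db, h.cd, ← h.det]⟩

theorem lift_mk (h : IsBSL q α β γ δ) (w : FreeAlgebra ℂ Gen) : lift h (mk q w) =
    FreeAlgebra.lift ℂ (fun | .a => α | .b => β | .c => γ | .d => δ) w :=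
  RingQuot.liftAlgHom_mkAlgHom_apply ..

variable (h : IsBSL q α β γ δ)

@[simp] theorem lift_a : lift h (a q) = α := by simp [a, of, lift_mk]
@[simp] theorem lift_b : lift h (b q) = β := by simp [b, of, lift_mk]
@[simp] theorem lift_c : lift h (c q) = γ := by simp [c, of, lift_mk]
@[simp] theorem lift_d : lift h (d q) = δ := by simp [d, of, lift_mk]

end lift

variable {q : ℂ}

/-- To prove a property of all elements, it suffices to treat `1`, linear combinations, and left
multiplication by a generator. -/
theorem induction_left {p : Alg q → Prop} (one : p 1) (add : ∀ x y, p x → p y → p (x + y))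
    (smul : ∀ (r : ℂ) x, p x → p (r • x)) (mul : ∀ g x, p x → p (of q g * x)) (x : Alg q) :
    p x := by
  obtain ⟨w, rfl⟩ := mk_surjective q x
  suffices ∀ x, p x → p (mk q w * x) by simpa using this 1 one
  induction w with
  | grade0 r => intro x hx; simpa [Algebra.smul_def] using smul r x hx
  | grade1 g => exact mul g
  | mul u v hu hv => intro x hx; simpa [mul_assoc] using hu _ (hv x hx)
  | add u v hu hv => intro x hx; simpa [add_mul] using add _ _ (hu x hx) (hv x hx)

theorem induction_right {p : Alg q → Prop} (one : p 1) (add : ∀ x y, p x → p y → p (x + y))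
    (smul : ∀ (r : ℂ) x, p x → p (r • x)) (mul : ∀ g x, p x → p (x * of q g)) (x : Alg q) :
    p x := by
  obtain ⟨w, rfl⟩ := mk_surjective q x
  suffices ∀ x, p x → p (x * mk q w) by simpa using this 1 one
  induction w with
  | grade0 r => intro x hx; simpa [Algebra.algebraMap_eq_smul_one] using smul r x hx
  | grade1 g => exact mul g
  | mul u v hu hv => intro x hx; simpa [mul_assoc] using hv _ (hu x hx)
  | add u v hu hv => intro x hx; simpa [mul_add] using add _ _ (hu x hx) (hv x hx)

theorem linearMap_ext_left {N : Type*} [AddCommGroup N] [Module ℂ N] {F G : Alg q →ₗ[ℂ] N}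
    (one : F 1 = G 1) (mul : ∀ g x, F x = G x → F (of q g * x) = G (of q g * x)) : F = G :=
  LinearMap.ext <| induction_left one (fun x y hx hy ↦ by rw [map_add, map_add, hx, hy])
    (fun r x hx ↦ by rw [map_smul, map_smul, hx]) mul

theorem of_a : of q .a = a q := rfl
theorem of_b : of q .b = b q := rfl
theorem of_c : of q .c = c q := rfl
theorem of_d : of q .d = d q := rfl

theorem isBSL (q : ℂ) : IsBSL q (a q) (b q) (c q) (d q) := by
  constructor <;> simp only [a, b, c, d, of, ← map_mul, ← map_smul, ← map_add, ← map_sub,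
    ← map_one (mk q)] <;>
  exact RingQuot.mkAlgHom_rel ℂ (by constructor)

/-- Read from left to right, and with `ad` reversed, the relations `ba`, `ca`, `ad`, `db` together
with this and the next two lemmas bring quadratic expressions in the generators to a normal form. -/
theorem IsBSL.cb [NeZero q] {A : Type*} [Ring A] [Algebra ℂ A] {a b c d : A}
    (h : IsBSL q a b c d) : c * b = (q ^ 2)⁻¹ • (a * d) - (q ^ 2)⁻¹ • 1 := by
  rw [← smul_sub, ← h.det, sub_sub_cancel, inv_smul_smul₀ (pow_ne_zero 2 (NeZero.ne q))]

theorem IsBSL.bc' [NeZero q] {A : Type*} [Ring A] [Algebra ℂ A] {a b c d : A}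
    (h : IsBSL q a b c d) : b * c = a * d - (q ^ 2)⁻¹ • 1 - (1 - (q ^ 2)⁻¹) • (a * a) := by
  rw [h.bc, h.cb, mul_sub]; module

theorem IsBSL.cd' {A : Type*} [Ring A] [Algebra ℂ A] {a b c d : A} (h : IsBSL q a b c d) :
    c * d = d * c + ((1 - (q ^ 2)⁻¹) * (q ^ 2)⁻¹) • (a * c) := by
  rw [h.cd, h.ca, mul_smul]

section mulAssoc

variable (z : Alg q)

theorem b_mul_a_mul : b q * (a q * z) = q ^ 2 • (a q * (b q * z)) := by
  rw [← mul_assoc, (isBSL q).ba, smul_mul_assoc, mul_assoc]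

theorem c_mul_a_mul : c q * (a q * z) = (q ^ 2)⁻¹ • (a q * (c q * z)) := by
  rw [← mul_assoc, (isBSL q).ca, smul_mul_assoc, mul_assoc]

theorem d_mul_a_mul : d q * (a q * z) = a q * (d q * z) := by
  rw [← mul_assoc, ← (isBSL q).ad, mul_assoc]

theorem b_mul_c_mul [NeZero q] : b q * (c q * z) =
    a q * (d q * z) - (q ^ 2)⁻¹ • z - (1 - (q ^ 2)⁻¹) • (a q * (a q * z)) := by
  rw [← mul_assoc, (isBSL q).bc', sub_mul, sub_mul]; simp only [smul_mul_assoc, one_mul, mul_assoc]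

theorem c_mul_b_mul [NeZero q] :
    c q * (b q * z) = (q ^ 2)⁻¹ • (a q * (d q * z)) - (q ^ 2)⁻¹ • z := by
  rw [← mul_assoc, (isBSL q).cb, sub_mul]; simp only [smul_mul_assoc, one_mul, mul_assoc]

theorem d_mul_b_mul : d q * (b q * z) =
    b q * (d q * z) + (1 - (q ^ 2)⁻¹) • (a q * (b q * z)) := by
  rw [← mul_assoc, (isBSL q).db, add_mul]; simp only [smul_mul_assoc, mul_assoc]

theorem c_mul_d_mul : c q * (d q * z) =
    d q * (c q * z) + ((1 - (q ^ 2)⁻¹) * (q ^ 2)⁻¹) • (a q * (c q * z)) := by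
  rw [← mul_assoc, (isBSL q).cd', add_mul]; simp only [smul_mul_assoc, mul_assoc]

end mulAssoc

theorem scaling_isBSL (q : ℂ) {s : ℂ} (hs : s ≠ 0) :
    IsBSL q (a q) (s⁻¹ • b q) (s • c q) (d q) := by
  have h := isBSL q
  constructor <;>
    try simp only [smul_mul_assoc, mul_smul_comm, inv_smul_smul₀ hs, smul_inv_smul₀ hs]
  · rw [h.ba, smul_comm]
  · rw [h.ca, smul_comm]
  · exact h.ad
  · exact h.bc
  · rw [h.db]; module
  · rw [h.cd]; module
  · exact h.det

variable [NeZero q]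

variable (q) in
theorem q_sq_ne_zero : q ^ 2 ≠ 0 := pow_ne_zero 2 (NeZero.ne q)

/-- The automorphism rescaling `b` by `q⁻²` and `c` by `q²`. -/
def κ : Alg q →ₐ[ℂ] Alg q := lift (scaling_isBSL q (q_sq_ne_zero q))

/-- The inverse of `κ`. -/
def κ' : Alg q →ₐ[ℂ] Alg q := lift (scaling_isBSL q (inv_ne_zero (q_sq_ne_zero q)))

@[simp] theorem κ_a : κ (a q) = a q := lift_a _
@[simp] theorem κ_b : κ (b q) = (q ^ 2)⁻¹ • b q := lift_b _
@[simp] theorem κ_c : κ (c q) = q ^ 2 • c q := lift_c _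
@[simp] theorem κ_d : κ (d q) = d q := lift_d _
@[simp] theorem κ'_a : κ' (a q) = a q := lift_a _
@[simp] theorem κ'_b : κ' (b q) = q ^ 2 • b q := by rw [κ', lift_b, inv_inv]
@[simp] theorem κ'_c : κ' (c q) = (q ^ 2)⁻¹ • c q := lift_c _
@[simp] theorem κ'_d : κ' (d q) = d q := lift_d _

@[simp] theorem κ_κ' (x : Alg q) : κ (κ' x) = x := by
  refine LinearMap.congr_fun (f := κ.toLinearMap ∘ₗ κ'.toLinearMap) (g := .id)
    (linearMap_ext_left (by simp) fun g x h ↦ ?_) x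
  simp only [LinearMap.comp_apply, AlgHom.toLinearMap_apply, LinearMap.id_apply] at h ⊢
  have := q_sq_ne_zero q
  cases g <;> simp [of_a, of_b, of_c, of_d, h, this]

@[simp] theorem κ'_κ (x : Alg q) : κ' (κ x) = x := by
  refine LinearMap.congr_fun (f := κ'.toLinearMap ∘ₗ κ.toLinearMap) (g := .id)
    (linearMap_ext_left (by simp) fun g x h ↦ ?_) x
  simp only [LinearMap.comp_apply, AlgHom.toLinearMap_apply, LinearMap.id_apply] at h ⊢
  have := q_sq_ne_zero q
  cases g <;> simp [of_a, of_b, of_c, of_d, h, this]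

/-- An algebra map to upper triangular matrices with diagonal entries `id` and `κ` has as its upper
right entry a skew derivation; this is how `X` is constructed. -/
theorem triangular_isBSL (q : ℂ) [NeZero q] : IsBSL q
    !![a q, (q ^ 4 - q ^ 2) • c q; 0, a q]
    !![b q, (1 - q ^ 2) • (a q - d q); 0, (q ^ 2)⁻¹ • b q]
    !![c q, 0; 0, q ^ 2 • c q]
    !![d q, (1 - q ^ 2) • c q; 0, d q] := by
  have h := isBSL q
  have hq := NeZero.ne q
  constructor <;> ext i j <;> fin_cases i <;> fin_cases j <;>
    simp [Matrix.mul_apply, mul_sub, sub_mul, h.ba, h.ca, ← h.ad, h.bc', h.cb,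
      h.db, h.cd', smul_smul, smul_sub, smul_add] <;>
    (match_scalars <;> field_simp <;> ring)

/-- The algebra map `x ↦ !![x, X x; 0, κ x]`, which defines `X`. -/
def triangular : Alg q →ₐ[ℂ] Matrix (Fin 2) (Fin 2) (Alg q) := lift (triangular_isBSL q)

theorem triangular_diag (x : Alg q) :
    triangular x 0 0 = x ∧ triangular x 1 0 = 0 ∧ triangular x 1 1 = κ x := by
  refine induction_left
    (p := fun x ↦ triangular x 0 0 = x ∧ triangular x 1 0 = 0 ∧ triangular x 1 1 = κ x)
    (by simp) (fun x y hx hy ↦ by simp [hx, hy]) (fun r x hx ↦ by simp [hx]) (fun g x hx ↦ ?_) x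
  cases g <;> simp [of_a, of_b, of_c, of_d, triangular, Matrix.mul_apply] <;>
    simp_all [triangular]

/-- The skew derivation, with `X (x y) = x X(y) + X(x) κ(y)`. -/
def X : Alg q →ₗ[ℂ] Alg q := Matrix.entryLinearMap ℂ (Alg q) 0 1 ∘ₗ triangular.toLinearMap

theorem X_apply (x : Alg q) : X x = triangular x 0 1 := rfl

@[simp] theorem X_one : X (1 : Alg q) = 0 := by simp [X_apply]
@[simp] theorem X_a : X (a q) = (q ^ 4 - q ^ 2) • c q := by simp [X_apply, triangular]
@[simp] theorem X_b : X (b q) = (1 - q ^ 2) • (a q - d q) := by simp [X_apply, triangular]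
@[simp] theorem X_c : X (c q) = 0 := by simp [X_apply, triangular]
@[simp] theorem X_d : X (d q) = (1 - q ^ 2) • c q := by simp [X_apply, triangular]

@[simp] theorem X_mul (x y : Alg q) : X (x * y) = x * X y + X x * κ y := by
  simp [X_apply, Matrix.mul_apply, triangular_diag]

theorem κ_X (x : Alg q) : κ (X x) = q ^ 2 • X (κ x) := by
  refine LinearMap.congr_fun (f := κ.toLinearMap ∘ₗ X) (g := q ^ 2 • X ∘ₗ κ.toLinearMap)
    (linearMap_ext_left (by simp) fun g x h ↦ ?_) x
  simp only [LinearMap.comp_apply, AlgHom.toLinearMap_apply, LinearMap.smul_apply] at h ⊢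
  have := q_sq_ne_zero q
  have hq := NeZero.ne q
  cases g <;> simp [of_a, of_b, of_c, of_d, h, this] <;> match_scalars <;> field_simp

@[simp] theorem X_κ (x : Alg q) : X (κ x) = (q ^ 2)⁻¹ • κ (X x) := by
  rw [κ_X, inv_smul_smul₀ (q_sq_ne_zero q)]

@[simp] theorem X_κ' (x : Alg q) : X (κ' x) = q ^ 2 • κ' (X x) := by
  have h := X_κ (κ' x)
  rw [κ_κ'] at h
  rw [h, map_smul, κ'_κ, smul_inv_smul₀ (q_sq_ne_zero q)]

end presentation

/-! ### The braiding -/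

section braiding

variable {q : ℂ} [NeZero q]
open TensorProduct LinearMap

/-- Three operators on a space, by which the generators `k`, `k⁻¹` and `x` of the Borel Hopf algebra
act. No relations between them are imposed: they are proved where they are used. -/
structure BorelAction (M : Type*) [AddCommGroup M] [Module ℂ M] where
  k : Module.End ℂ M
  k' : Module.End ℂ M
  x : Module.End ℂ M

variable (q) in
/-- The action on `Alg q` by `κ`, its inverse, and `X`. -/
@[simps] def borelB : BorelAction (Alg q) := ⟨κ.toLinearMap, κ'.toLinearMap, X⟩

variable (q) in
/-- The diagonal action on `Alg q ⊗ Alg q`, along `Δ k = k ⊗ k` and `Δ x = 1 ⊗ x + x ⊗ k`. -/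
@[simps] def borelBB : BorelAction (Alg q ⊗[ℂ] Alg q) where
  k := map (borelB q).k (borelB q).k
  k' := map (borelB q).k' (borelB q).k'
  x := map .id (borelB q).x + map (borelB q).x (borelB q).k

section pass

variable {M M' N N' : Type*} [AddCommGroup M] [Module ℂ M] [AddCommGroup M'] [Module ℂ M']
  [AddCommGroup N] [Module ℂ N] [AddCommGroup N'] [Module ℂ N']

/-- A linear map commuting with the three operators. -/
structure IsBorelHom (A : BorelAction M) (A' : BorelAction M') (φ : M →ₗ[ℂ] M') : Prop where
  k : ∀ m, φ (A.k m) = A'.k (φ m)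
  k' : ∀ m, φ (A.k' m) = A'.k' (φ m)
  x : ∀ m, φ (A.x m) = A'.x (φ m)

/-- The operator `m ⊗ n ↦ g₍₋₁₎ · m ⊗ f(g₍₀₎) n`, where `g ↦ g₍₋₁₎ ⊗ g₍₀₎` is the coaction of the
Borel Hopf algebra on the generators: `g` crosses `M` and then acts on `N` through `f`. -/
def pass (q : ℂ) (A : BorelAction M) (f : Gen → Module.End ℂ N) : Gen → Module.End ℂ (M ⊗[ℂ] N)
  | .a => map .id (f .a) + map A.x (f .b)
  | .b => map A.k (f .b)
  | .c => map A.k' (f .c) + map (A.k' ∘ₗ A.x) (f .d - f .a) - map (A.k' ∘ₗ A.x ∘ₗ A.x) (f .b)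
  | .d => map .id (f .d) - (q ^ 2)⁻¹ • map A.x (f .b)

variable (A : BorelAction M) {A' : BorelAction M'} (f : Gen → Module.End ℂ N) (m : M) (n : N)

theorem pass_a_tmul : pass q A f .a (m ⊗ₜ n) = m ⊗ₜ f .a n + A.x m ⊗ₜ f .b n := rfl

theorem pass_b_tmul : pass q A f .b (m ⊗ₜ n) = A.k m ⊗ₜ f .b n := rfl

theorem pass_c_tmul : pass q A f .c (m ⊗ₜ n) = A.k' m ⊗ₜ f .c n + A.k' (A.x m) ⊗ₜ f .d n -
    A.k' (A.x m) ⊗ₜ f .a n - A.k' (A.x (A.x m)) ⊗ₜ f .b n := by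
  simp [pass, tmul_sub, add_sub_assoc]

theorem pass_d_tmul :
    pass q A f .d (m ⊗ₜ n) = m ⊗ₜ f .d n - (q ^ 2)⁻¹ • A.x m ⊗ₜ f .b n := rfl

variable {A f}

/-- Crossing is natural in both factors. -/
theorem IsBorelHom.pass_map {φ : M →ₗ[ℂ] M'} (hφ : IsBorelHom A A' φ)
    {f' : Gen → Module.End ℂ N'} {ρ : N →ₗ[ℂ] N'} (hρ : ∀ g n, ρ (f g n) = f' g (ρ n))
    (g : Gen) (t : M ⊗[ℂ] N) : map φ ρ (pass q A f g t) = pass q A' f' g (map φ ρ t) := by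
  induction t with
  | zero => simp
  | add s t hs ht => simp only [map_add, hs, ht]
  | tmul m n => cases g <;> simp [pass_a_tmul, pass_b_tmul, pass_c_tmul, pass_d_tmul, hφ.k, hφ.k',
      hφ.x, hρ]

theorem IsBorelHom.id : IsBorelHom A A (.id : M →ₗ[ℂ] M) := ⟨fun _ ↦ rfl, fun _ ↦ rfl, fun _ ↦ rfl⟩

theorem IsBorelHom.pass_rTensor {φ : M →ₗ[ℂ] M'} (hφ : IsBorelHom A A' φ)
    (g : Gen) (t : M ⊗[ℂ] N) : φ.rTensor N (pass q A f g t) = pass q A' f g (φ.rTensor N t) :=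
  hφ.pass_map (f' := f) (ρ := .id) (fun _ _ ↦ rfl) g t

theorem pass_lTensor {f' : Gen → Module.End ℂ N'} {ρ : N →ₗ[ℂ] N'}
    (hρ : ∀ g n, ρ (f g n) = f' g (ρ n))
    (g : Gen) (t : M ⊗[ℂ] N) : ρ.lTensor M (pass q A f g t) = pass q A f' g (ρ.lTensor M t) :=
  IsBorelHom.id.pass_map (φ := .id) hρ g t

/-- Crossing `Alg q ⊗ Alg q` at once is crossing the two factors in turn. This expresses that the
coaction is coassociative. -/
theorem pass_pass (g : Gen) (t : (Alg q ⊗[ℂ] Alg q) ⊗[ℂ] N) :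
    TensorProduct.assoc ℂ _ _ _ (pass q (borelBB q) f g t) =
      pass q (borelB q) (pass q (borelB q) f) g (TensorProduct.assoc ℂ _ _ _ t) := by
  revert t
  refine LinearMap.congr_fun (f := (TensorProduct.assoc ℂ _ _ _).toLinearMap ∘ₗ
    pass q (borelBB q) f g) (g := pass q (borelB q) (pass q (borelB q) f) g ∘ₗ
      (TensorProduct.assoc ℂ _ _ _).toLinearMap) (TensorProduct.ext_threefold fun y z n ↦ ?_)
  have := NeZero.ne q
  cases g <;> simp [pass_a_tmul, pass_b_tmul, pass_c_tmul, pass_d_tmul, add_tmul, sub_tmul,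
    tmul_add, tmul_sub, ← smul_tmul'] <;>
  (match_scalars <;> field_simp <;> ring)

end pass

variable (q) in
/-- Left multiplication by a generator. -/
abbrev mulGen (g : Gen) : Module.End ℂ (Alg q) := mulLeft ℂ (of q g)

@[simp] theorem mulGen_apply (g : Gen) (x : Alg q) : mulGen q g x = of q g * x := rfl

/-- The coaction respects the relations of the algebra. -/
theorem pass_isBSL : IsBSL q (pass q (borelB q) (mulGen q) .a) (pass q (borelB q) (mulGen q) .b)
    (pass q (borelB q) (mulGen q) .c) (pass q (borelB q) (mulGen q) .d) := by
  have hq := NeZero.ne q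
  constructor <;> refine TensorProduct.ext' fun y z ↦ ?_ <;>
  simp [pass_a_tmul, pass_b_tmul, pass_c_tmul, pass_d_tmul, of_a, of_b, of_c, of_d, b_mul_a_mul,
    c_mul_a_mul, d_mul_a_mul, b_mul_c_mul, c_mul_b_mul, d_mul_b_mul,
    c_mul_d_mul, mul_sub, tmul_add, tmul_sub, ← smul_tmul'] <;>
  (match_scalars <;> field_simp <;> ring)

/-- Left multiplication by `1 ⊗ x` in the braided tensor square:
`L x (y ⊗ z) = x₍₋₁₎ · y ⊗ x₍₀₎ z = ψ(x ⊗ y) z`. -/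
def L : Alg q →ₐ[ℂ] Module.End ℂ (Alg q ⊗[ℂ] Alg q) := lift pass_isBSL

theorem L_of (g : Gen) : L (of q g) = pass q (borelB q) (mulGen q) g := by
  cases g
  exacts [lift_a _, lift_b _, lift_c _, lift_d _]

theorem L_a_tmul (y z : Alg q) : L (a q) (y ⊗ₜ z) = y ⊗ₜ (a q * z) + X y ⊗ₜ (b q * z) := by
  rw [← of_a, L_of, pass_a_tmul]; rfl

theorem L_b_tmul (y z : Alg q) : L (b q) (y ⊗ₜ z) = κ y ⊗ₜ (b q * z) := by
  rw [← of_b, L_of, pass_b_tmul]; rfl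

theorem L_c_tmul (y z : Alg q) : L (c q) (y ⊗ₜ z) = κ' y ⊗ₜ (c q * z) +
    κ' (X y) ⊗ₜ (d q * z) - κ' (X y) ⊗ₜ (a q * z) - κ' (X (X y)) ⊗ₜ (b q * z) := by
  rw [← of_c, L_of, pass_c_tmul]; rfl

theorem L_d_tmul (y z : Alg q) : L (d q) (y ⊗ₜ z) =
    y ⊗ₜ (d q * z) - (q ^ 2)⁻¹ • X y ⊗ₜ (b q * z) := by
  rw [← of_d, L_of, pass_d_tmul]; rfl

theorem L_mul_apply (x y : Alg q) (t : Alg q ⊗[ℂ] Alg q) : L (x * y) t = L x (L y t) := by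
  rw [map_mul L, Module.End.mul_apply]

theorem L_mul_right (x : Alg q) (t : Alg q ⊗[ℂ] Alg q) (z : Alg q) :
    L x (t * 1 ⊗ₜ z) = L x t * 1 ⊗ₜ z := by
  induction x using induction_left generalizing t with
  | one => simp
  | add x y hx hy => simp only [map_add, LinearMap.add_apply, hx, hy, add_mul]
  | smul r x hx => simp only [map_smul, LinearMap.smul_apply, hx, smul_mul_assoc]
  | mul g x hx =>
    rw [L_mul_apply, L_mul_apply, hx]
    induction L x t with
    | zero => simp
    | add s t hs ht => simp only [map_add, add_mul, hs, ht]
    | tmul y w => cases g <;> simp [of_a, of_b, of_c, of_d, L_a_tmul, L_b_tmul, L_c_tmul, L_d_tmul,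
        add_mul, sub_mul, mul_assoc]

/-- The braiding `x ⊗ y ↦ x₍₋₁₎ · y ⊗ x₍₀₎`. -/
def ψ : Alg q ⊗[ℂ] Alg q →ₗ[ℂ] Alg q ⊗[ℂ] Alg q :=
  TensorProduct.lift ((LinearMap.lcomp ℂ _ ((TensorProduct.mk ℂ (Alg q) (Alg q)).flip 1)) ∘ₗ
    L.toLinearMap)

theorem ψ_tmul (x y : Alg q) : ψ (x ⊗ₜ y) = L x (y ⊗ₜ 1) := rfl

theorem L_tmul (x y z : Alg q) : L x (y ⊗ₜ z) = ψ (x ⊗ₜ y) * 1 ⊗ₜ z := by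
  rw [ψ_tmul, ← L_mul_right]; simp

theorem ψ_mul_tmul (x y z : Alg q) : ψ ((x * y) ⊗ₜ z) = L x (ψ (y ⊗ₜ z)) := by
  simp [ψ_tmul]

theorem ψ_one_tmul (x : Alg q) : ψ (1 ⊗ₜ x) = x ⊗ₜ 1 := by simp [ψ_tmul]

/-- A generator crosses a product in the first leg one factor at a time. -/
theorem L_tmul_one_mul_a (y : Alg q) (t : Alg q ⊗[ℂ] Alg q) :
    L (a q) (y ⊗ₜ 1 * t) = y ⊗ₜ 1 * L (a q) t + X y ⊗ₜ 1 * L (b q) t := by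
  induction t with
  | zero => simp
  | add s t hs ht => simp only [map_add, mul_add, hs, ht]; abel
  | tmul w z => simp [L_a_tmul, L_b_tmul, mul_add, add_tmul, add_assoc]

theorem L_tmul_one_mul_b (y : Alg q) (t : Alg q ⊗[ℂ] Alg q) :
    L (b q) (y ⊗ₜ 1 * t) = κ y ⊗ₜ 1 * L (b q) t := by
  induction t with
  | zero => simp
  | add s t hs ht => simp only [map_add, mul_add, hs, ht]
  | tmul w z => simp [L_b_tmul]

theorem L_tmul_one_mul_c (y : Alg q) (t : Alg q ⊗[ℂ] Alg q) :
    L (c q) (y ⊗ₜ 1 * t) = κ' y ⊗ₜ 1 * L (c q) t + κ' (X y) ⊗ₜ 1 * L (d q) t -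
      κ' (X y) ⊗ₜ 1 * L (a q) t - κ' (X (X y)) ⊗ₜ 1 * L (b q) t := by
  have hq := NeZero.ne q
  induction t with
  | zero => simp
  | add s t hs ht => simp only [map_add, mul_add, hs, ht]; abel
  | tmul w z =>
    simp [L_a_tmul, L_b_tmul, L_c_tmul, L_d_tmul, mul_add, add_tmul, mul_sub, sub_tmul,
      ← smul_tmul']
    match_scalars <;> field_simp <;> ring

theorem L_tmul_one_mul_d (y : Alg q) (t : Alg q ⊗[ℂ] Alg q) :
    L (d q) (y ⊗ₜ 1 * t) = y ⊗ₜ 1 * L (d q) t - (q ^ 2)⁻¹ • X y ⊗ₜ 1 * L (b q) t := by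
  induction t with
  | zero => simp
  | add s t hs ht => simp only [map_add, mul_add, hs, ht, smul_add]; abel
  | tmul w z =>
    simp [L_b_tmul, L_d_tmul, mul_add, add_tmul, mul_sub, sub_tmul, ← smul_tmul']
    abel

/-- Multiplication from the right by `w ⊗ 1` in the braided tensor square. -/
def braidedMulRight (w : Alg q) : Alg q ⊗[ℂ] Alg q →ₗ[ℂ] Alg q ⊗[ℂ] Alg q :=
  mul12 ℂ (Alg q) ∘ₗ leg23 ℂ ψ ∘ₗ (TensorProduct.assoc ℂ _ _ _).toLinearMap ∘ₗ
    (TensorProduct.mk ℂ _ _).flip w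

theorem mul12_tmul (y : Alg q) (t : Alg q ⊗[ℂ] Alg q) : mul12 ℂ (Alg q) (y ⊗ₜ t) = y ⊗ₜ 1 * t := by
  induction t with
  | zero => simp
  | add s t hs ht => simp only [tmul_add, map_add, mul_add, hs, ht]
  | tmul w z => simp [mul12]

theorem braidedMulRight_tmul (w y z : Alg q) :
    braidedMulRight w (y ⊗ₜ z) = y ⊗ₜ 1 * ψ (z ⊗ₜ w) := by
  simp [braidedMulRight, leg23, mul12_tmul]

theorem L_braidedMulRight_of (w : Alg q) (g : Gen) (t : Alg q ⊗[ℂ] Alg q) :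
    L (of q g) (braidedMulRight w t) = braidedMulRight w (L (of q g) t) := by
  induction t with
  | zero => simp
  | add s t hs ht => simp only [map_add, hs, ht]
  | tmul y z => cases g <;> simp only [of_a, of_b, of_c, of_d, braidedMulRight_tmul, L_a_tmul,
      L_b_tmul, L_c_tmul, L_d_tmul, L_tmul_one_mul_a, L_tmul_one_mul_b, L_tmul_one_mul_c,
      L_tmul_one_mul_d, map_add, map_sub, map_smul, ψ_mul_tmul, smul_mul_assoc]

/-- The hexagon `ψ (id ⊗ m) = (m ⊗ id) (id ⊗ ψ) (ψ ⊗ id)`. -/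
theorem ψ_tmul_mul (x y w : Alg q) : ψ (x ⊗ₜ (y * w)) = braidedMulRight w (ψ (x ⊗ₜ y)) := by
  induction x using induction_left with
  | one => simp [ψ_one_tmul, braidedMulRight_tmul]
  | add x y hx hy => simp only [map_add, add_tmul, hx, hy]
  | smul r x hx => simp only [map_smul, ← smul_tmul', hx]
  | mul g x hx => rw [ψ_mul_tmul, hx, ψ_mul_tmul, L_braidedMulRight_of]

theorem ψ_tmul_one (x : Alg q) : ψ (x ⊗ₜ 1) = 1 ⊗ₜ x := by
  induction x using induction_left with
  | one => simp [ψ_one_tmul]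
  | add x y hx hy => simp only [map_add, add_tmul, tmul_add, hx, hy]
  | smul r x hx => simp only [map_smul, ← smul_tmul', hx, tmul_smul]
  | mul g x hx =>
    rw [ψ_mul_tmul, hx]
    cases g <;> simp [of_a, of_b, of_c, of_d, L_a_tmul, L_b_tmul, L_c_tmul, L_d_tmul]

end braiding

/-! ### Compatibility with the product and the Yang–Baxter equation -/

section yangBaxter

variable {q : ℂ} [NeZero q]
open TensorProduct LinearMap

theorem ψ_mul_left : ψ ∘ₗ mul12 ℂ (Alg q) = mul23 ℂ (Alg q) ∘ₗ leg12 ℂ ψ ∘ₗ leg23 ℂ ψ := by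
  refine TensorProduct.ext' fun x t ↦ ?_
  induction t with
  | zero => simp
  | add s t hs ht => simp only [map_add, tmul_add, hs, ht]
  | tmul y z =>
    have key (t : Alg q ⊗[ℂ] Alg q) : mul23 ℂ (Alg q) (leg12 ℂ ψ (x ⊗ₜ t)) = L x t := by
      induction t with
      | zero => simp
      | add s t hs ht => simp only [map_add, tmul_add, hs, ht]
      | tmul y z =>
        rw [L_tmul]
        simp only [leg12, LinearMap.comp_apply, LinearEquiv.coe_coe, assoc_symm_tmul,
          rTensor_tmul]
        induction ψ (x ⊗ₜ[ℂ] y) with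
        | zero => simp
        | add s t hs ht => simp only [map_add, add_tmul, add_mul, hs, ht]
        | tmul v w => simp [mul23]
    simp [mul12, leg23, ψ_mul_tmul, key]

theorem leg12_tmul (x y z : Alg q) : leg12 ℂ ψ (x ⊗ₜ (y ⊗ₜ z)) =
    TensorProduct.assoc ℂ _ _ _ (ψ (x ⊗ₜ y) ⊗ₜ z) := by
  simp [leg12]

theorem ψ_mul_right : ψ ∘ₗ mul23 ℂ (Alg q) = mul12 ℂ (Alg q) ∘ₗ leg23 ℂ ψ ∘ₗ leg12 ℂ ψ := by
  refine TensorProduct.ext_threefold' fun x y z ↦ ?_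
  simp [mul23, ψ_tmul_mul, braidedMulRight, leg12_tmul]

theorem ψ_k (t : Alg q ⊗[ℂ] Alg q) : ψ (map κ.toLinearMap κ.toLinearMap t) =
    map κ.toLinearMap κ.toLinearMap (ψ t) := by
  induction t with
  | zero => simp
  | add s t hs ht => simp only [map_add, hs, ht]
  | tmul x y =>
    induction x using induction_left with
    | one => simp [ψ_one_tmul]
    | add x y hx hy => simp only [map_add, add_tmul, hx, hy]
    | smul r x hx => simp only [map_smul, ← smul_tmul', hx]
    | mul g x hx =>
      have h : ψ (κ x ⊗ₜ κ y) = map κ.toLinearMap κ.toLinearMap (ψ (x ⊗ₜ y)) := hx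
      simp only [map_tmul, AlgHom.toLinearMap_apply, map_mul, ψ_mul_tmul, h]
      induction ψ (x ⊗ₜ[ℂ] y) with
      | zero => simp
      | add s t hs ht => simp only [map_add, hs, ht]
      | tmul y z =>
        have := NeZero.ne q
        cases g <;> simp [of_a, of_b, of_c, of_d, L_a_tmul, L_b_tmul, L_c_tmul, L_d_tmul,
          ← smul_tmul'] <;>
        (match_scalars <;> field_simp)

/-- The Yetter–Drinfeld compatibility of the action of `x` with the coaction, on a generator. -/
theorem x_L (g : Gen) (t : Alg q ⊗[ℂ] Alg q) : (borelBB q).x (L (of q g) t) =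
    L (of q g) ((borelBB q).x t) + L (X (of q g)) ((borelBB q).k t) := by
  have := NeZero.ne q
  induction t with
  | zero => simp
  | add s t hs ht => simp only [map_add, hs, ht]; abel
  | tmul y z =>
    cases g <;> simp [of_a, of_b, of_c, of_d, L_a_tmul, L_b_tmul, L_c_tmul, L_d_tmul,
          ← smul_tmul', tmul_add, tmul_sub, mul_sub, sub_mul] <;>
    (match_scalars <;> field_simp <;> ring)

theorem ψ_x (t : Alg q ⊗[ℂ] Alg q) : ψ ((borelBB q).x t) = (borelBB q).x (ψ t) := by
  induction t with
  | zero => simp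
  | add s t hs ht => simp only [map_add, hs, ht]
  | tmul x y =>
    induction x using induction_left with
    | one => simp [ψ_one_tmul]
    | add x y hx hy => simp only [map_add, add_tmul, hx, hy]
    | smul r x hx => simp only [map_smul, ← smul_tmul', hx]
    | mul g x hx =>
      have hk := ψ_k (x ⊗ₜ[ℂ] y)
      rw [ψ_mul_tmul, x_L, ← hx, borelBB_k, borelB_k, ← hk]
      simp [ψ_mul_tmul, add_tmul, add_assoc]

theorem k_k' (t : Alg q ⊗[ℂ] Alg q) : (borelBB q).k ((borelBB q).k' t) = t := by
  induction t with
  | zero => simp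
  | add s t hs ht => simp only [map_add, hs, ht]
  | tmul x y => simp

theorem k'_k (t : Alg q ⊗[ℂ] Alg q) : (borelBB q).k' ((borelBB q).k t) = t := by
  induction t with
  | zero => simp
  | add s t hs ht => simp only [map_add, hs, ht]
  | tmul x y => simp

theorem isBorelHom_ψ : IsBorelHom (borelBB q) (borelBB q) ψ where
  k := ψ_k
  k' t := by
    nth_rw 2 [← k_k' t]
    rw [show ψ ((borelBB q).k ((borelBB q).k' t)) = (borelBB q).k _ from ψ_k _, k'_k]
  x := ψ_x

theorem leg23_leg12_mul (g : Gen) (x : Alg q) (t : Alg q ⊗[ℂ] Alg q) :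
    leg23 ℂ ψ (leg12 ℂ ψ ((of q g * x) ⊗ₜ t)) =
      pass q (borelB q) (fun g ↦ L (of q g)) g (leg23 ℂ ψ (leg12 ℂ ψ (x ⊗ₜ t))) := by
  induction t with
  | zero => simp
  | add s t hs ht => simp only [map_add, tmul_add, hs, ht]
  | tmul y z =>
    rw [leg12_tmul, leg12_tmul, ψ_mul_tmul]
    induction ψ (x ⊗ₜ[ℂ] y) with
    | zero => simp
    | add s t hs ht => simp only [map_add, add_tmul, hs, ht]
    | tmul v w =>
      simp only [assoc_tmul, leg23, lTensor_tmul]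
      cases g <;> simp [pass_a_tmul, pass_b_tmul, pass_c_tmul, pass_d_tmul, of_a, of_b, of_c, of_d,
        L_a_tmul, L_b_tmul, L_c_tmul, L_d_tmul, ψ_mul_tmul, add_tmul, sub_tmul, ← smul_tmul']

theorem pass_L (g : Gen) (t : Alg q ⊗[ℂ] (Alg q ⊗[ℂ] Alg q)) :
    pass q (borelB q) (fun g ↦ L (of q g)) g t = TensorProduct.assoc ℂ _ _ _
      (pass q (borelBB q) (mulGen q) g ((TensorProduct.assoc ℂ _ _ _).symm t)) := by
  rw [pass_pass, LinearEquiv.apply_symm_apply]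
  simp only [L_of]

/-- As `ψ` commutes with the diagonal action, a generator can cross the two factors before or after
they are braided. -/
theorem leg12_pass_L (g : Gen) (t : Alg q ⊗[ℂ] (Alg q ⊗[ℂ] Alg q)) :
    leg12 ℂ ψ (pass q (borelB q) (fun g ↦ L (of q g)) g t) =
      pass q (borelB q) (fun g ↦ L (of q g)) g (leg12 ℂ ψ t) := by
  rw [pass_L, pass_L]
  simp only [leg12, LinearMap.comp_apply, LinearEquiv.coe_coe, LinearEquiv.symm_apply_apply,
    isBorelHom_ψ.pass_rTensor]

theorem leg23_leg12_one (t : Alg q ⊗[ℂ] Alg q) : leg23 ℂ ψ (leg12 ℂ ψ (1 ⊗ₜ t)) =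
    TensorProduct.assoc ℂ _ _ _ (t ⊗ₜ 1) := by
  induction t with
  | zero => simp
  | add s t hs ht => simp only [map_add, add_tmul, tmul_add, hs, ht]
  | tmul y z => simp [leg12_tmul, leg23, ψ_one_tmul]

theorem yang_baxter : leg12 ℂ ψ ∘ₗ leg23 ℂ ψ ∘ₗ leg12 ℂ ψ =
    leg23 ℂ (ψ (q := q)) ∘ₗ leg12 ℂ ψ ∘ₗ leg23 ℂ ψ := by
  refine TensorProduct.ext' fun x t ↦ ?_
  simp only [LinearMap.comp_apply]
  rw [show leg23 ℂ ψ (x ⊗ₜ t) = x ⊗ₜ ψ t from rfl]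
  induction x using induction_left with
  | one =>
    rw [leg23_leg12_one, leg23_leg12_one]
    simp [leg12]
  | add x y hx hy => simp only [map_add, add_tmul, hx, hy]
  | smul r x hx => simp only [map_smul, ← smul_tmul', hx]
  | mul g x hx => rw [leg23_leg12_mul, leg23_leg12_mul, leg12_pass_L, hx]

end yangBaxter

/-! ### Invertibility of the braiding -/

section inverse

variable {q : ℂ} [NeZero q]
open TensorProduct LinearMap MulOpposite

variable (q) in
/-- A generator `g` crossing from right to left: `x ⊗ y ↦ x g₍₀₎ ⊗ S⁻¹(g₍₋₁₎) · y` for the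
antipode `S` of the Borel Hopf algebra. -/
def inverseOperator : Gen → Module.End ℂ (Alg q ⊗[ℂ] Alg q)
  | .a => map (mulRight ℂ (a q)) .id - map (mulRight ℂ (b q)) (κ'.toLinearMap ∘ₗ X)
  | .b => map (mulRight ℂ (b q)) κ'.toLinearMap
  | .c => map (mulRight ℂ (c q)) κ.toLinearMap - (q ^ 2)⁻¹ • map (mulRight ℂ (d q - a q)) X -
      (q ^ 2)⁻¹ • map (mulRight ℂ (b q)) (κ'.toLinearMap ∘ₗ X ∘ₗ X)
  | .d => map (mulRight ℂ (d q)) .id + (q ^ 2)⁻¹ • map (mulRight ℂ (b q)) (κ'.toLinearMap ∘ₗ X)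

theorem inverseOperator_isBSL : IsBSL q (op (inverseOperator q .a)) (op (inverseOperator q .b))
    (op (inverseOperator q .c)) (op (inverseOperator q .d)) := by
  have hq := NeZero.ne q
  have h := isBSL q
  constructor <;> apply unop_injective <;> refine TensorProduct.ext' fun y z ↦ ?_ <;>
  simp [inverseOperator, mul_assoc, h.ba, h.ca, ← h.ad, h.bc', h.cb, h.db, h.cd', sub_mul,
    mul_sub, mul_add, add_tmul, sub_tmul, ← smul_tmul'] <;>
  (match_scalars <;> field_simp <;> ring)

/-- The extension of `inverseOperator` to the whole algebra; it reverses products. -/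
def inverseHom : Alg q →ₐ[ℂ] (Module.End ℂ (Alg q ⊗[ℂ] Alg q))ᵐᵒᵖ := lift inverseOperator_isBSL

theorem inverseHom_of (g : Gen) : inverseHom (of q g) = op (inverseOperator q g) := by
  cases g
  exacts [lift_a _, lift_b _, lift_c _, lift_d _]

/-- The inverse braiding. -/
def ψinv : Alg q ⊗[ℂ] Alg q →ₗ[ℂ] Alg q ⊗[ℂ] Alg q :=
  TensorProduct.lift (LinearMap.flip
    ((LinearMap.lcomp ℂ _ (TensorProduct.mk ℂ (Alg q) (Alg q) 1)) ∘ₗ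
      (opLinearEquiv ℂ).symm.toLinearMap ∘ₗ inverseHom.toLinearMap))

theorem ψinv_tmul (x y : Alg q) : ψinv (y ⊗ₜ x) = unop (inverseHom x) (1 ⊗ₜ y) := rfl

theorem ψinv_tmul_one (y : Alg q) : ψinv (y ⊗ₜ 1) = 1 ⊗ₜ y := by simp [ψinv_tmul]

theorem ψinv_tmul_mul (x y : Alg q) (g : Gen) :
    ψinv (y ⊗ₜ (x * of q g)) = inverseOperator q g (ψinv (y ⊗ₜ x)) := by
  rw [ψinv_tmul, ψinv_tmul, map_mul inverseHom, inverseHom_of]; rfl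

theorem ψ_inverseOperator (g : Gen) (t : Alg q ⊗[ℂ] Alg q) :
    ψ (inverseOperator q g t) = (mulRight ℂ (of q g)).lTensor _ (ψ t) := by
  have key (t : Alg q ⊗[ℂ] Alg q) (z : Alg q) : t * 1 ⊗ₜ z = (mulRight ℂ z).lTensor _ t := by
    induction t with
    | zero => simp
    | add s t hs ht => simp only [map_add, add_mul, hs, ht]
    | tmul y z => simp
  have hq := NeZero.ne q
  induction t with
  | zero => simp
  | add s t hs ht => simp only [map_add, hs, ht]
  | tmul x y =>
    rw [← key, ← L_tmul]
    cases g <;> simp [inverseOperator, of_a, of_b, of_c, of_d, ψ_mul_tmul, mul_sub, sub_tmul,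
      ← smul_tmul', ψ_tmul (a q), ψ_tmul (b q), ψ_tmul (c q), ψ_tmul (d q), L_a_tmul,
      L_b_tmul, L_c_tmul, L_d_tmul] <;>
    (match_scalars <;> field_simp <;> ring)

theorem ψ_ψinv (t : Alg q ⊗[ℂ] Alg q) : ψ (ψinv t) = t := by
  induction t with
  | zero => simp
  | add s t hs ht => simp only [map_add, hs, ht]
  | tmul y x =>
    induction x using induction_right with
    | one => simp [ψinv_tmul_one, ψ_one_tmul]
    | add x y hx hy => simp only [map_add, tmul_add, hx, hy]
    | smul r x hx => simp only [map_smul, tmul_smul, hx]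
    | mul g x hx => rw [ψinv_tmul_mul, ψ_inverseOperator, hx]; simp

theorem ψinv_mul_one_tmul (g : Gen) (t : Alg q ⊗[ℂ] Alg q) :
    ψinv (t * 1 ⊗ₜ of q g) = inverseOperator q g (ψinv t) := by
  induction t with
  | zero => simp
  | add s t hs ht => simp only [map_add, add_mul, hs, ht]
  | tmul y x => rw [← ψinv_tmul_mul]; simp

theorem inverseOperator_mulLeft (g : Gen) (x : Alg q) (t : Alg q ⊗[ℂ] Alg q) :
    inverseOperator q g ((mulLeft ℂ x).rTensor _ t) =
      (mulLeft ℂ x).rTensor _ (inverseOperator q g t) := by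
  induction t with
  | zero => simp
  | add s t hs ht => simp only [map_add, hs, ht]
  | tmul y z => cases g <;> simp [inverseOperator, mul_assoc]

theorem ψinv_L_of (g : Gen) (t : Alg q ⊗[ℂ] Alg q) :
    ψinv (L (of q g) t) = (mulLeft ℂ (of q g)).rTensor _ (ψinv t) := by
  induction t with
  | zero => simp
  | add s t hs ht => simp only [map_add, hs, ht]
  | tmul y x =>
    induction x using induction_right with
    | one =>
      have h (g : Gen) (y : Alg q) : ψinv (y ⊗ₜ of q g) = inverseOperator q g (1 ⊗ₜ y) := by
        simpa [ψinv_tmul_one] using ψinv_tmul_mul 1 y g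
      have ha := h .a
      have hb := h .b
      have hc := h .c
      have hd := h .d
      rw [of_a] at ha
      rw [of_b] at hb
      rw [of_c] at hc
      rw [of_d] at hd
      have hq := NeZero.ne q
      cases g <;> simp [of_a, of_b, of_c, of_d, L_a_tmul, L_b_tmul, L_c_tmul, L_d_tmul, ha, hb,
        hc, hd, inverseOperator, ψinv_tmul_one, sub_tmul, ← smul_tmul'] <;>
      (match_scalars <;> field_simp <;> ring)
    | add x y hx hy => simp only [map_add, tmul_add, hx, hy]
    | smul r x hx => simp only [map_smul, tmul_smul, hx]
    | mul g' x hx =>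
      have h : y ⊗ₜ[ℂ] (x * of q g') = y ⊗ₜ x * 1 ⊗ₜ of q g' := by simp
      rw [h, L_mul_right, ψinv_mul_one_tmul, hx, ψinv_mul_one_tmul, inverseOperator_mulLeft]

theorem ψinv_ψ (t : Alg q ⊗[ℂ] Alg q) : ψinv (ψ t) = t := by
  induction t with
  | zero => simp
  | add s t hs ht => simp only [map_add, hs, ht]
  | tmul x y =>
    induction x using induction_left with
    | one => simp [ψ_one_tmul, ψinv_tmul_one]
    | add x y hx hy => simp only [map_add, add_tmul, hx, hy]
    | smul r x hx => simp only [map_smul, ← smul_tmul', hx]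
    | mul g x hx => rw [ψ_mul_tmul, ψinv_L_of, hx]; simp

theorem ψ_bijective : Function.Bijective (ψ (q := q)) :=
  Function.bijective_iff_has_inverse.2 ⟨ψinv, ψinv_ψ, ψ_ψinv⟩

end inverse

/-! ### The braided tensor square -/

section square

variable {q : ℂ} [NeZero q]
open TensorProduct LinearMap

section liftAlong

variable {U : Type*} [AddCommGroup U] [Module ℂ U] {μ : U →ₗ[ℂ] Module.End ℂ U} {e : U}

/-- The universal property for a space `U` whose product is given by its left multiplications
`μ : U → End U`, with unit `e`: four vectors whose left multiplications satisfy the relations define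
a linear map, which is multiplicative if `μ` is associative (`liftAlong_mul`). -/
def liftAlong {u v w z : U} (h : IsBSL q (μ u) (μ v) (μ w) (μ z)) (e : U) : Alg q →ₗ[ℂ] U :=
  LinearMap.applyₗ e ∘ₗ (lift h).toLinearMap

variable {u v w z : U} (h : IsBSL q (μ u) (μ v) (μ w) (μ z))

theorem liftAlong_one : liftAlong h e 1 = e := by simp [liftAlong]

theorem liftAlong_apply (x : Alg q) : liftAlong h e x = lift h x e := rfl

theorem lift_eq_liftAlong (hμ : ∀ u, μ u e = u) (one : μ e = 1)
    (mul : ∀ u v, μ u * μ v = μ (μ u v)) (x : Alg q) : lift h x = μ (liftAlong h e x) := by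
  induction x using induction_left with
  | one => simp [liftAlong_one, one]
  | add x y hx hy => simp only [map_add, hx, hy]
  | smul r x hx => simp only [map_smul, hx]
  | mul g x hx =>
    obtain ⟨s, hs⟩ : ∃ s, lift h (of q g) = μ s := by
      cases g
      exacts [⟨_, lift_a h⟩, ⟨_, lift_b h⟩, ⟨_, lift_c h⟩, ⟨_, lift_d h⟩]
    rw [liftAlong_apply, map_mul (lift h), hs, hx, mul, hμ]

theorem liftAlong_mul (hμ : ∀ u, μ u e = u) (one : μ e = 1) (mul : ∀ u v, μ u * μ v = μ (μ u v))
    (x y : Alg q) : liftAlong h e (x * y) = μ (liftAlong h e x) (liftAlong h e y) := by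
  rw [liftAlong_apply, map_mul (lift h), Module.End.mul_apply, ← liftAlong_apply h y,
    lift_eq_liftAlong h hμ one mul]

theorem liftAlong_a (hμ : ∀ u, μ u e = u) : liftAlong h e (a q) = u := by simp [liftAlong, hμ]
theorem liftAlong_b (hμ : ∀ u, μ u e = u) : liftAlong h e (b q) = v := by simp [liftAlong, hμ]
theorem liftAlong_c (hμ : ∀ u, μ u e = u) : liftAlong h e (c q) = w := by simp [liftAlong, hμ]
theorem liftAlong_d (hμ : ∀ u, μ u e = u) : liftAlong h e (d q) = z := by simp [liftAlong, hμ]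

end liftAlong

variable (q) in
/-- Left multiplication by `x ⊗ 1`. -/
def A : Alg q →ₐ[ℂ] Module.End ℂ (Alg q ⊗[ℂ] Alg q) :=
  (Algebra.lmul ℂ _).comp Algebra.TensorProduct.includeLeft

theorem A_apply (x : Alg q) (t : Alg q ⊗[ℂ] Alg q) : A q x t = x ⊗ₜ 1 * t := rfl
theorem A_tmul (x y z : Alg q) : A q x (y ⊗ₜ z) = (x * y) ⊗ₜ z := by simp [A_apply]

variable (q) in
/-- Left multiplication in the braided tensor square, `x ⊗ y ↦ (x ⊗ 1) L(y)`. -/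
def μ : Alg q ⊗[ℂ] Alg q →ₗ[ℂ] Module.End ℂ (Alg q ⊗[ℂ] Alg q) :=
  TensorProduct.lift ((LinearMap.mul ℂ (Module.End ℂ (Alg q ⊗[ℂ] Alg q))).compl₁₂
    (A q).toLinearMap L.toLinearMap)

theorem μ_tmul (x y : Alg q) : μ q (x ⊗ₜ y) = A q x * L y := rfl

theorem μ_tmul_apply (x y : Alg q) (t : Alg q ⊗[ℂ] Alg q) : μ q (x ⊗ₜ y) t = A q x (L y t) := rfl

theorem μ_apply_one (t : Alg q ⊗[ℂ] Alg q) : μ q t (1 ⊗ₜ 1) = t := by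
  induction t with
  | zero => simp
  | add s t hs ht => simp only [map_add, LinearMap.add_apply, hs, ht]
  | tmul x y => simp [μ_tmul_apply, A_apply, L_tmul, ψ_tmul_one]

theorem μ_one : μ q (1 ⊗ₜ 1) = 1 := by simp [μ_tmul]

theorem μ_apply_tmul (t : Alg q ⊗[ℂ] Alg q) (y z : Alg q) :
    μ q t (y ⊗ₜ z) = braidedMulRight y t * 1 ⊗ₜ z := by
  induction t with
  | zero => simp
  | add s t hs ht => simp only [map_add, LinearMap.add_apply, hs, ht, add_mul]
  | tmul x y => simp [μ_tmul_apply, A_apply, L_tmul, braidedMulRight_tmul, mul_assoc]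

/-- The cross relation of the braided tensor square: `(1 ⊗ x)(y ⊗ 1) = ψ(x ⊗ y)`. -/
theorem L_mul_A (x y : Alg q) : L x * A q y = μ q (ψ (x ⊗ₜ y)) := by
  refine TensorProduct.ext' fun z w ↦ ?_
  rw [μ_apply_tmul, ← ψ_tmul_mul, Module.End.mul_apply, A_tmul, L_tmul]

theorem μ_A (x : Alg q) (t : Alg q ⊗[ℂ] Alg q) : μ q (A q x t) = A q x * μ q t := by
  induction t with
  | zero => simp
  | add s t hs ht => simp only [map_add, hs, ht, mul_add]
  | tmul y z => rw [A_tmul, μ_tmul, μ_tmul, map_mul, mul_assoc]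

theorem μ_mul_right (t : Alg q ⊗[ℂ] Alg q) (x : Alg q) : μ q (t * 1 ⊗ₜ x) = μ q t * L x := by
  induction t with
  | zero => simp
  | add s t hs ht => simp only [map_add, hs, ht, add_mul]
  | tmul y z => simp [μ_tmul, mul_assoc]

/-- The braided tensor square is associative. -/
theorem μ_mul_μ (s t : Alg q ⊗[ℂ] Alg q) : μ q s * μ q t = μ q (μ q s t) := by
  induction s with
  | zero => simp
  | add s s' hs hs' => simp only [map_add, hs, hs', add_mul, LinearMap.add_apply]
  | tmul x y =>
    induction t with
    | zero => simp
    | add s t hs ht => simp only [map_add, hs, ht, mul_add]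
    | tmul z w =>
      rw [μ_tmul_apply, μ_A, L_tmul, μ_mul_right, ← L_mul_A, μ_tmul, μ_tmul]
      simp only [mul_assoc]

theorem braidedMul_tmul (s t : Alg q ⊗[ℂ] Alg q) : braidedMul ℂ ψ (s ⊗ₜ t) = μ q s t := by
  induction s with
  | zero => simp
  | add s s' hs hs' => simp only [map_add, add_tmul, hs, hs', LinearMap.add_apply]
  | tmul x y =>
    induction t with
    | zero => simp
    | add s t hs ht => simp only [map_add, hs, ht, tmul_add]
    | tmul z w =>
      rw [μ_tmul_apply, L_tmul, A_apply]
      simp only [braidedMul, LinearMap.comp_apply, LinearEquiv.coe_coe, assoc_tmul, lTensor_tmul,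
        leg12_tmul]
      induction ψ (y ⊗ₜ[ℂ] z) with
      | zero => simp
      | add s t hs ht => simp only [map_add, add_tmul, tmul_add, add_mul, mul_add, hs, ht]
      | tmul _ _ => simp

variable (q) in
/-- The coproduct of a generator. -/
def comulGen : Gen → Alg q ⊗[ℂ] Alg q
  | .a => a q ⊗ₜ a q + q ^ 4 • (c q ⊗ₜ b q)
  | .b => (1 - q ^ 2) • (a q ⊗ₜ b q) + b q ⊗ₜ a q + q ^ 2 • (d q ⊗ₜ b q)
  | .c => (1 - q ^ 2) • (c q ⊗ₜ a q) + a q ⊗ₜ c q + q ^ 2 • (c q ⊗ₜ d q)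
  | .d => (q ^ 2 - 1) • (a q ⊗ₜ a q) + (q ^ 4 - q ^ 2) • (c q ⊗ₜ b q)
    + q ^ 2 • (b q ⊗ₜ c q) + (1 - q ^ 2) • (a q ⊗ₜ d q) + (1 - q ^ 2) • (d q ⊗ₜ a q)
    + q ^ 2 • (d q ⊗ₜ d q)

set_option maxHeartbeats 4000000 in
/-- The coproducts of the generators satisfy the relations in the braided tensor square. -/
theorem comulGen_isBSL : IsBSL q (μ q (comulGen q .a)) (μ q (comulGen q .b))
    (μ q (comulGen q .c)) (μ q (comulGen q .d)) := by
  have hq := NeZero.ne q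
  have h := isBSL q
  constructor <;> simp only [← map_sub, μ_mul_μ, ← map_smul, ← map_add, ← μ_one] <;>
    refine congrArg (μ q) ?_ <;>
  simp [comulGen, A_apply, μ_tmul_apply, L_a_tmul, L_b_tmul, L_c_tmul, L_d_tmul, sub_tmul,
    tmul_sub, mul_sub, mul_add, tmul_add, add_tmul, sub_mul, add_mul, ← smul_tmul',
    h.ba, h.ca, ← h.ad, h.bc', h.cb, h.db, h.cd', smul_add, smul_sub] <;>
  (match_scalars <;> field_simp <;> ring)

end square

/-! ### Counit, coproduct and antipode -/

section structureMaps

variable {q : ℂ} [NeZero q]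
open TensorProduct LinearMap

variable (q) in
/-- The counit. -/
def counit : Alg q →ₐ[ℂ] ℂ :=
  lift (α := (1 : ℂ)) (β := 0) (γ := 0) (δ := 1) (by constructor <;> simp)

@[simp] theorem counit_a : counit q (a q) = 1 := lift_a _
@[simp] theorem counit_b : counit q (b q) = 0 := lift_b _
@[simp] theorem counit_c : counit q (c q) = 0 := lift_c _
@[simp] theorem counit_d : counit q (d q) = 1 := lift_d _

@[simp] theorem counit_κ (x : Alg q) : counit q (κ x) = counit q x := by
  induction x using induction_left with
  | one => simp
  | add x y hx hy => simp only [map_add, hx, hy]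
  | smul r x hx => simp only [map_smul, hx]
  | mul g x hx => cases g <;> simp [of_a, of_b, of_c, of_d, hx]

@[simp] theorem counit_X (x : Alg q) : counit q (X x) = 0 := by
  induction x using induction_left with
  | one => simp
  | add x y hx hy => simp only [map_add, hx, hy, add_zero]
  | smul r x hx => simp only [map_smul, hx, smul_zero]
  | mul g x hx => cases g <;> simp [of_a, of_b, of_c, of_d, hx]

@[simp] theorem counit_κ' (x : Alg q) : counit q (κ' x) = counit q x := by
  rw [← counit_κ, κ_κ']

variable (q) in
/-- The coproduct, multiplicative for the braided tensor square. -/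
def comul : Alg q →ₗ[ℂ] Alg q ⊗[ℂ] Alg q := liftAlong comulGen_isBSL (1 ⊗ₜ 1)

theorem comul_of (g : Gen) : comul q (of q g) = comulGen q g := by
  cases g
  exacts [liftAlong_a _ μ_apply_one, liftAlong_b _ μ_apply_one, liftAlong_c _ μ_apply_one,
    liftAlong_d _ μ_apply_one]

theorem comul_a : comul q (a q) = comulGen q .a := comul_of _
theorem comul_b : comul q (b q) = comulGen q .b := comul_of _
theorem comul_c : comul q (c q) = comulGen q .c := comul_of _
theorem comul_d : comul q (d q) = comulGen q .d := comul_of _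

theorem comul_one : comul q 1 = 1 ⊗ₜ 1 := liftAlong_one _

theorem comul_mul (x y : Alg q) : comul q (x * y) = μ q (comul q x) (comul q y) :=
  liftAlong_mul _ μ_apply_one μ_one μ_mul_μ x y

theorem k_L (x : Alg q) (t : Alg q ⊗[ℂ] Alg q) :
    (borelBB q).k (L x t) = L (κ x) ((borelBB q).k t) := by
  have key (t : Alg q ⊗[ℂ] Alg q) (z : Alg q) :
      (borelBB q).k (t * 1 ⊗ₜ z) = (borelBB q).k t * 1 ⊗ₜ κ z := by
    induction t with
    | zero => simp
    | add s t hs ht => simp only [map_add, add_mul, hs, ht]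
    | tmul y z => simp
  induction t with
  | zero => simp
  | add s t hs ht => simp only [map_add, hs, ht]
  | tmul y z => rw [L_tmul, key, ← isBorelHom_ψ.k]; simp [L_tmul]

theorem x_L_apply (x : Alg q) (t : Alg q ⊗[ℂ] Alg q) : (borelBB q).x (L x t) =
    L x ((borelBB q).x t) + L (X x) ((borelBB q).k t) := by
  induction x using induction_left generalizing t with
  | one => simp
  | add x y hx hy => simp only [map_add, LinearMap.add_apply, hx, hy]; abel
  | smul r x hx => simp only [map_smul, LinearMap.smul_apply, hx, smul_add]
  | mul g x hx =>
    rw [L_mul_apply, x_L, hx, X_mul, map_add L, L_mul_apply, LinearMap.add_apply, L_mul_apply,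
      L_mul_apply, k_L, map_add, add_assoc]

theorem k_A (x : Alg q) (t : Alg q ⊗[ℂ] Alg q) :
    (borelBB q).k (A q x t) = A q (κ x) ((borelBB q).k t) := by
  induction t with
  | zero => simp
  | add s t hs ht => simp only [map_add, hs, ht]
  | tmul y z => simp [A_tmul]

theorem x_A (x : Alg q) (t : Alg q ⊗[ℂ] Alg q) : (borelBB q).x (A q x t) =
    A q x ((borelBB q).x t) + A q (X x) ((borelBB q).k t) := by
  induction t with
  | zero => simp
  | add s t hs ht => simp only [map_add, hs, ht]; abel
  | tmul y z => simp [A_tmul, add_tmul, add_assoc]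

/-- The operators `k` and `x` act on the braided tensor square as an automorphism and as a skew
derivation. -/
theorem k_μ (s t : Alg q ⊗[ℂ] Alg q) :
    (borelBB q).k (μ q s t) = μ q ((borelBB q).k s) ((borelBB q).k t) := by
  induction s with
  | zero => simp
  | add s s' hs hs' => simp only [map_add, LinearMap.add_apply, hs, hs']
  | tmul x y => rw [μ_tmul_apply, k_A, k_L]; rfl

theorem x_μ (s t : Alg q ⊗[ℂ] Alg q) : (borelBB q).x (μ q s t) =
    μ q s ((borelBB q).x t) + μ q ((borelBB q).x s) ((borelBB q).k t) := by
  induction s with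
  | zero => simp
  | add s s' hs hs' => simp only [map_add, LinearMap.add_apply, hs, hs']; abel
  | tmul x y =>
    rw [μ_tmul_apply, x_A, x_L_apply, k_L, map_add, ← μ_tmul_apply, ← μ_tmul_apply,
      ← μ_tmul_apply, add_assoc, ← LinearMap.add_apply, ← map_add]
    rfl

theorem IsBorelHom.of_inverse {M M' : Type*} [AddCommGroup M] [Module ℂ M] [AddCommGroup M']
    [Module ℂ M'] {A : BorelAction M} {A' : BorelAction M'} {φ : M →ₗ[ℂ] M'}
    (h : ∀ m, A.k (A.k' m) = m) (h' : ∀ m, A'.k' (A'.k m) = m) (k : ∀ m, φ (A.k m) = A'.k (φ m))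
    (x : ∀ m, φ (A.x m) = A'.x (φ m)) : IsBorelHom A A' φ :=
  ⟨k, fun m ↦ by rw [← h' (φ (A.k' m)), ← k, h], x⟩

theorem comul_κ (x : Alg q) : comul q (κ x) = (borelBB q).k (comul q x) := by
  induction x using induction_left with
  | one => simp [comul_one]
  | add x y hx hy => simp only [map_add, hx, hy]
  | smul r x hx => simp only [map_smul, hx]
  | mul g x hx =>
    rw [map_mul, comul_mul, comul_mul, k_μ, ← hx]
    congr 2
    have hq := NeZero.ne q
    cases g <;> simp [of_a, of_b, of_c, of_d, comul_a, comul_b, comul_c, comul_d, comulGen,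
      ← smul_tmul'] <;> (match_scalars <;> field_simp)

theorem isBorelHom_comul : IsBorelHom (borelB q) (borelBB q) (comul q) := by
  refine .of_inverse κ_κ' k'_k comul_κ fun x ↦ ?_
  rw [borelB_x]
  induction x using induction_left with
  | one => simp [comul_one]
  | add x y hx hy => simp only [map_add, hx, hy]
  | smul r x hx => simp only [map_smul, hx]
  | mul g x hx =>
    rw [X_mul, map_add, comul_mul, comul_mul, comul_mul, x_μ, hx, comul_κ]
    congr 3
    have hq := NeZero.ne q
    cases g <;> simp [of_a, of_b, of_c, of_d, comul_a, comul_b, comul_c, comul_d, comulGen,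
      ← smul_tmul', sub_tmul, tmul_sub] <;> (match_scalars <;> field_simp <;> ring)

variable (q) in
/-- Left multiplication for the braided-opposite product `m ψ` on the algebra. -/
def C : Alg q →ₗ[ℂ] Module.End ℂ (Alg q) := TensorProduct.curry (LinearMap.mul' ℂ (Alg q) ∘ₗ ψ)

theorem C_apply (x y : Alg q) : C q x y = LinearMap.mul' ℂ (Alg q) (ψ (x ⊗ₜ y)) := rfl

theorem C_a (y : Alg q) : C q (a q) y = y * a q + X y * b q := by
  simp [C_apply, ψ_tmul, L_a_tmul]

theorem C_b (y : Alg q) : C q (b q) y = κ y * b q := by simp [C_apply, ψ_tmul, L_b_tmul]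

theorem C_c (y : Alg q) : C q (c q) y =
    κ' y * c q + κ' (X y) * d q - κ' (X y) * a q - κ' (X (X y)) * b q := by
  simp [C_apply, ψ_tmul, L_c_tmul]

theorem C_d (y : Alg q) : C q (d q) y = y * d q - (q ^ 2)⁻¹ • (X y * b q) := by
  simp [C_apply, ψ_tmul, L_d_tmul]

theorem C_apply_one (x : Alg q) : C q x 1 = x := by simp [C_apply, ψ_tmul_one]

theorem C_one : C q 1 = 1 := by ext x; simp [C_apply, ψ_one_tmul]

/-- The product `m ψ` is associative, by the hexagons and the Yang–Baxter equation. -/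
theorem C_mul_C (x y : Alg q) : C q x * C q y = C q (C q x y) := by
  ext z
  have assoc (t : Alg q ⊗[ℂ] (Alg q ⊗[ℂ] Alg q)) : LinearMap.mul' ℂ _ (mul12 ℂ (Alg q) t) =
      LinearMap.mul' ℂ _ (mul23 ℂ (Alg q) t) := by
    revert t
    exact LinearMap.congr_fun (f := LinearMap.mul' ℂ _ ∘ₗ mul12 ℂ (Alg q))
      (g := LinearMap.mul' ℂ _ ∘ₗ mul23 ℂ (Alg q))
      (TensorProduct.ext_threefold' fun x y z ↦ by simp [mul12, mul23, mul_assoc])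
  have h₁ : C q x (C q y z) =
      LinearMap.mul' ℂ _ (ψ (mul23 ℂ (Alg q) (leg23 ℂ ψ (x ⊗ₜ (y ⊗ₜ z))))) := rfl
  have h₂ : C q (C q x y) z =
      LinearMap.mul' ℂ _ (ψ (mul12 ℂ (Alg q) (leg12 ℂ ψ (x ⊗ₜ (y ⊗ₜ z))))) := by
    rw [leg12_tmul, C_apply]
    simp [mul12, C_apply]
  rw [Module.End.mul_apply, h₁, h₂]
  have e₁ := LinearMap.congr_fun (ψ_mul_right (q := q)) (leg23 ℂ ψ (x ⊗ₜ (y ⊗ₜ z)))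
  have e₂ := LinearMap.congr_fun (ψ_mul_left (q := q)) (leg12 ℂ ψ (x ⊗ₜ (y ⊗ₜ z)))
  have e₃ := LinearMap.congr_fun (yang_baxter (q := q)) (x ⊗ₜ (y ⊗ₜ z))
  simp only [LinearMap.comp_apply] at e₁ e₂ e₃
  rw [e₁, e₂, e₃, assoc]

/-- The antipodes of the generators satisfy the relations for the product `m ψ`. -/
theorem antipode_isBSL : IsBSL q (C q (d q)) (C q (-((q ^ 2)⁻¹ • b q)))
    (C q (-((q ^ 2)⁻¹ • c q))) (C q ((q ^ 2)⁻¹ • a q + (1 - (q ^ 2)⁻¹) • d q)) := by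
  have hq := NeZero.ne q
  have h := isBSL q
  constructor <;> simp only [← map_sub, C_mul_C, ← map_smul, ← map_add, ← C_one] <;>
    refine congrArg (C q) ?_ <;>
  simp [C_a, C_b, C_c, C_d, mul_sub, mul_add, sub_mul, add_mul,
    h.ba, h.ca, ← h.ad, h.bc', h.cb, h.db, h.cd', smul_add, smul_sub] <;>
  (match_scalars <;> field_simp <;> ring)

variable (q) in
/-- The antipode, multiplicative from the given product to `m ψ`. -/
def S : Alg q →ₗ[ℂ] Alg q := liftAlong antipode_isBSL 1

@[simp] theorem S_a : S q (a q) = d q := liftAlong_a _ C_apply_one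
@[simp] theorem S_b : S q (b q) = -((q ^ 2)⁻¹ • b q) := liftAlong_b _ C_apply_one
@[simp] theorem S_c : S q (c q) = -((q ^ 2)⁻¹ • c q) := liftAlong_c _ C_apply_one
@[simp] theorem S_d : S q (d q) = (q ^ 2)⁻¹ • a q + (1 - (q ^ 2)⁻¹) • d q :=
  liftAlong_d _ C_apply_one

theorem S_one : S q 1 = 1 := liftAlong_one _

theorem S_mul (x y : Alg q) : S q (x * y) = C q (S q x) (S q y) :=
  liftAlong_mul _ C_apply_one C_one C_mul_C x y

theorem k_C (x y : Alg q) : κ (C q x y) = C q (κ x) (κ y) := by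
  have key (t : Alg q ⊗[ℂ] Alg q) : κ (LinearMap.mul' ℂ _ t) =
      LinearMap.mul' ℂ _ ((borelBB q).k t) := by
    induction t with
    | zero => simp
    | add s t hs ht => simp only [map_add, hs, ht]
    | tmul y z => simp
  rw [C_apply, key, ← isBorelHom_ψ.k]
  rfl

theorem x_C (x y : Alg q) : X (C q x y) = C q x (X y) + C q (X x) (κ y) := by
  have key (t : Alg q ⊗[ℂ] Alg q) : X (LinearMap.mul' ℂ _ t) =
      LinearMap.mul' ℂ _ ((borelBB q).x t) := by
    induction t with
    | zero => simp
    | add s t hs ht => simp only [map_add, hs, ht]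
    | tmul y z => simp
  rw [C_apply, key, ← isBorelHom_ψ.x, C_apply, C_apply, ← map_add, ← map_add]
  rfl

theorem S_κ (x : Alg q) : S q (κ x) = κ (S q x) := by
  induction x using induction_left with
  | one => simp [S_one]
  | add x y hx hy => simp only [map_add, hx, hy]
  | smul r x hx => simp only [map_smul, hx]
  | mul g x hx =>
    rw [map_mul, S_mul, S_mul, k_C, ← hx]
    congr 2
    cases g <;> simp [of_a, of_b, of_c, of_d, smul_smul, mul_comm]

theorem isBorelHom_S : IsBorelHom (borelB q) (borelB q) (S q) := by
  refine .of_inverse κ_κ' κ'_κ S_κ fun x ↦ ?_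
  rw [borelB_x]
  induction x using induction_left with
  | one => simp [S_one]
  | add x y hx hy => simp only [map_add, hx, hy]
  | smul r x hx => simp only [map_smul, hx]
  | mul g x hx =>
    rw [X_mul, map_add, S_mul, S_mul, S_mul, x_C, hx, S_κ]
    congr 3
    have hq := NeZero.ne q
    cases g <;> simp [of_a, of_b, of_c, of_d] <;> (match_scalars <;> field_simp <;> ring)

end structureMaps

/-! ### Counit laws, coassociativity, and the braiding against the coproduct -/

section coalgebra

variable {q : ℂ} [NeZero q]
open TensorProduct LinearMap

theorem rTensor_counit_L (g : Gen) (t : Alg q ⊗[ℂ] Alg q) :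
    (counit q).toLinearMap.rTensor _ (L (of q g) t) =
      (mulLeft ℂ (of q g)).lTensor _ ((counit q).toLinearMap.rTensor _ t) := by
  induction t with
  | zero => simp
  | add s t hs ht => simp only [map_add, hs, ht]
  | tmul y z => cases g <;> simp [of_a, of_b, of_c, of_d, L_a_tmul, L_b_tmul, L_c_tmul, L_d_tmul]

theorem lTensor_counit_L (g : Gen) (t : Alg q ⊗[ℂ] Alg q) :
    (counit q).toLinearMap.lTensor _ (L (of q g) t) =
      counit q (of q g) • ((counit q).toLinearMap.lTensor _ t) := by
  induction t with
  | zero => simp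
  | add s t hs ht => simp only [map_add, hs, ht, smul_add]
  | tmul y z => cases g <;> simp [of_a, of_b, of_c, of_d, L_a_tmul, L_b_tmul, L_c_tmul, L_d_tmul]

theorem rTensor_counit_A (x : Alg q) (t : Alg q ⊗[ℂ] Alg q) :
    (counit q).toLinearMap.rTensor _ (A q x t) =
      counit q x • ((counit q).toLinearMap.rTensor _ t) := by
  induction t with
  | zero => simp
  | add s t hs ht => simp only [map_add, hs, ht, smul_add]
  | tmul y z => simp [A_tmul, smul_tmul']

theorem lTensor_counit_A (x : Alg q) (t : Alg q ⊗[ℂ] Alg q) :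
    (counit q).toLinearMap.lTensor _ (A q x t) =
      (mulLeft ℂ x).rTensor _ ((counit q).toLinearMap.lTensor _ t) := by
  induction t with
  | zero => simp
  | add s t hs ht => simp only [map_add, hs, ht]
  | tmul y z => simp [A_tmul]

theorem rTensor_counit_comul (x : Alg q) :
    (counit q).toLinearMap.rTensor _ (comul q x) = 1 ⊗ₜ x := by
  induction x using induction_left with
  | one => simp [comul_one]
  | add x y hx hy => simp only [map_add, hx, hy, tmul_add]
  | smul r x hx => simp only [map_smul, hx, tmul_smul]
  | mul g x hx =>
    have ha (t) := rTensor_counit_L (q := q) .a t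
    have hb (t) := rTensor_counit_L (q := q) .b t
    have hc (t) := rTensor_counit_L (q := q) .c t
    have hd (t) := rTensor_counit_L (q := q) .d t
    simp only [of_a, of_b, of_c, of_d] at ha hb hc hd
    rw [comul_mul, comul_of]
    cases g <;> simp [of_a, of_b, of_c, of_d, comulGen, μ_tmul_apply, rTensor_counit_A, ha,
      hb, hc, hd, hx] <;>
    module

theorem lTensor_counit_comul (x : Alg q) :
    (counit q).toLinearMap.lTensor _ (comul q x) = x ⊗ₜ 1 := by
  induction x using induction_left with
  | one => simp [comul_one]
  | add x y hx hy => simp only [map_add, hx, hy, add_tmul]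
  | smul r x hx => simp only [map_smul, hx, smul_tmul']
  | mul g x hx =>
    have ha (t) := lTensor_counit_L (q := q) .a t
    have hb (t) := lTensor_counit_L (q := q) .b t
    have hc (t) := lTensor_counit_L (q := q) .c t
    have hd (t) := lTensor_counit_L (q := q) .d t
    simp only [of_a, of_b, of_c, of_d] at ha hb hc hd
    rw [comul_mul, comul_of]
    cases g <;> simp [of_a, of_b, of_c, of_d, comulGen, μ_tmul_apply, lTensor_counit_A, ha,
      hb, hc, hd, hx] <;>
    module

theorem ψ_counit_left : (counit q).toLinearMap.lTensor _ ∘ₗ ψ =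
    (TensorProduct.comm ℂ ℂ (Alg q)).toLinearMap ∘ₗ (counit q).toLinearMap.rTensor _ := by
  refine TensorProduct.ext' fun x y ↦ ?_
  simp only [LinearMap.comp_apply]
  induction x using induction_left with
  | one => simp [ψ_one_tmul]
  | add x y hx hy => simp only [map_add, add_tmul, hx, hy]
  | smul r x hx => simp only [map_smul, ← smul_tmul', hx]
  | mul g x hx => rw [ψ_mul_tmul, lTensor_counit_L, hx]; simp [← tmul_smul]

theorem ψ_counit_right : (counit q).toLinearMap.rTensor _ ∘ₗ ψ =
    (TensorProduct.comm ℂ (Alg q) ℂ).toLinearMap ∘ₗ (counit q).toLinearMap.lTensor _ := by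
  refine TensorProduct.ext' fun x y ↦ ?_
  simp only [LinearMap.comp_apply]
  induction x using induction_left with
  | one => simp [ψ_one_tmul]
  | add x y hx hy => simp only [map_add, add_tmul, hx, hy]
  | smul r x hx => simp only [map_smul, ← smul_tmul', hx]
  | mul g x hx => rw [ψ_mul_tmul, rTensor_counit_L, hx]; simp

variable (q) in
/-- A generator crosses the first leg and multiplies the second. -/
abbrev passA (g : Gen) : Module.End ℂ (Alg q ⊗[ℂ] (Alg q ⊗[ℂ] Alg q)) :=
  pass q (borelB q) (fun g ↦ A q (of q g)) g

variable (q) in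
/-- A generator crosses the first two legs and multiplies the third. -/
abbrev passL (g : Gen) : Module.End ℂ (Alg q ⊗[ℂ] (Alg q ⊗[ℂ] Alg q)) :=
  pass q (borelB q) (fun g ↦ L (of q g)) g

variable (q) in
/-- A generator crosses the first leg and its coproduct multiplies the other two. -/
abbrev passComul (g : Gen) : Module.End ℂ (Alg q ⊗[ℂ] (Alg q ⊗[ℂ] Alg q)) :=
  pass q (borelB q) (fun g ↦ μ q (comulGen q g)) g

variable (q) in
/-- A generator multiplies the first leg. -/
abbrev mulFirst (g : Gen) : Module.End ℂ (Alg q ⊗[ℂ] (Alg q ⊗[ℂ] Alg q)) :=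
  (mulGen q g).rTensor _

/-- The coproduct commutes with the coaction: a generator may be split before or after it crosses
the first leg. -/
theorem passComul_eq (g : Gen) (t : Alg q ⊗[ℂ] (Alg q ⊗[ℂ] Alg q)) : passComul q g t = match g with
  | .a => passA q .a (passL q .a t) + q ^ 4 • passA q .c (passL q .b t)
  | .b => (1 - q ^ 2) • passA q .a (passL q .b t) + passA q .b (passL q .a t) +
      q ^ 2 • passA q .d (passL q .b t)
  | .c => (1 - q ^ 2) • passA q .c (passL q .a t) + passA q .a (passL q .c t) +
      q ^ 2 • passA q .c (passL q .d t)
  | .d => (q ^ 2 - 1) • passA q .a (passL q .a t) + (q ^ 4 - q ^ 2) • passA q .c (passL q .b t) +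
      q ^ 2 • passA q .b (passL q .c t) + (1 - q ^ 2) • passA q .a (passL q .d t) +
      (1 - q ^ 2) • passA q .d (passL q .a t) + q ^ 2 • passA q .d (passL q .d t) := by
  have hq := NeZero.ne q
  induction t with
  | zero => cases g <;> simp
  | add s t hs ht => cases g <;> simp only [map_add, hs, ht] <;> module
  | tmul y t =>
    cases g <;> simp [pass_a_tmul, pass_b_tmul, pass_c_tmul, pass_d_tmul, of_a, of_b, of_c, of_d,
      comulGen, μ_tmul_apply, tmul_add, tmul_sub, ← smul_tmul'] <;>
    (match_scalars <;> field_simp <;> ring)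

theorem comul2_L (g : Gen) (t : Alg q ⊗[ℂ] Alg q) :
    comul2 ℂ (comul q) (L (of q g) t) = passComul q g (comul2 ℂ (comul q) t) := by
  rw [L_of]
  exact pass_lTensor (fun g n ↦ by rw [mulGen_apply, comul_mul, comul_of]) g t

theorem comul1_L (g : Gen) (t : Alg q ⊗[ℂ] Alg q) :
    comul1 ℂ (comul q) (L (of q g) t) = passL q g (comul1 ℂ (comul q) t) := by
  rw [L_of, passL, pass_L]
  simp only [comul1, LinearMap.comp_apply, LinearEquiv.coe_coe, LinearEquiv.symm_apply_apply,
    isBorelHom_comul.pass_rTensor]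

theorem ψ_comul_right :
    comul1 ℂ (comul q) ∘ₗ ψ = leg23 ℂ ψ ∘ₗ leg12 ℂ ψ ∘ₗ comul2 ℂ (comul q) := by
  refine TensorProduct.ext' fun x y ↦ ?_
  simp only [LinearMap.comp_apply, show comul2 ℂ (comul q) (x ⊗ₜ y) = x ⊗ₜ comul q y from rfl]
  induction x using induction_left with
  | one =>
    simp only [ψ_one_tmul]
    have : comul1 ℂ (comul q) (y ⊗ₜ 1) = TensorProduct.assoc ℂ _ _ _ (comul q y ⊗ₜ 1) := by
      simp [comul1]
    rw [this, leg23_leg12_one]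
  | add x y hx hy => simp only [map_add, add_tmul, hx, hy]
  | smul r x hx => simp only [map_smul, ← smul_tmul', hx]
  | mul g x hx => rw [ψ_mul_tmul, comul1_L, leg23_leg12_mul, hx]

theorem leg12_mulFirst (g : Gen) (t : Alg q ⊗[ℂ] (Alg q ⊗[ℂ] Alg q)) :
    leg12 ℂ ψ (mulFirst q g t) = passA q g (leg12 ℂ ψ t) := by
  revert t
  refine LinearMap.congr_fun (f := leg12 ℂ ψ ∘ₗ mulFirst q g) (g := passA q g ∘ₗ leg12 ℂ ψ)
    (TensorProduct.ext_threefold' fun x y z ↦ ?_)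
  simp only [LinearMap.comp_apply, rTensor_tmul, leg12_tmul, mulGen_apply, ψ_mul_tmul]
  induction ψ (x ⊗ₜ[ℂ] y) with
  | zero => simp
  | add s t hs ht => simp only [map_add, add_tmul, hs, ht]
  | tmul v w => cases g <;> simp [pass_a_tmul, pass_b_tmul, pass_c_tmul, pass_d_tmul, of_a, of_b,
      of_c, of_d, L_a_tmul, L_b_tmul, L_c_tmul, L_d_tmul, A_tmul, add_tmul, sub_tmul, ← smul_tmul']

theorem ψ_comul_left :
    comul2 ℂ (comul q) ∘ₗ ψ = leg12 ℂ ψ ∘ₗ leg23 ℂ ψ ∘ₗ comul1 ℂ (comul q) := by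
  refine TensorProduct.ext' fun x y ↦ ?_
  -- `O` sends `x ⊗ x'` to the result of letting `x'` and then `x` cross `y`
  let O : Alg q ⊗[ℂ] Alg q →ₗ[ℂ] Alg q ⊗[ℂ] (Alg q ⊗[ℂ] Alg q) :=
    leg12 ℂ ψ ∘ₗ (ψ ∘ₗ (TensorProduct.mk ℂ _ _).flip y).lTensor _
  have O_tmul (t : Alg q ⊗[ℂ] Alg q) :
      leg12 ℂ ψ (leg23 ℂ ψ (TensorProduct.assoc ℂ _ _ _ (t ⊗ₜ y))) = O t := by
    induction t with
    | zero => simp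
    | add s t hs ht => simp only [map_add, add_tmul, hs, ht]
    | tmul v w => simp [O, leg23]
  have hL (g t) : O (L (of q g) t) = passL q g (O t) := by
    simp only [O, LinearMap.comp_apply]
    rw [L_of, pass_lTensor (f' := fun g ↦ L (of q g)), leg12_pass_L]
    intro g n
    simp [ψ_mul_tmul]
  have hA (g t) : O (A q (of q g) t) = passA q g (O t) := by
    simp only [O, LinearMap.comp_apply]
    rw [← leg12_mulFirst]
    congr 1
    induction t with
    | zero => simp
    | add s t hs ht => simp only [map_add, hs, ht]
    | tmul v w => simp [A_tmul]
  have key (g : Gen) (t : Alg q ⊗[ℂ] Alg q) : O (μ q (comulGen q g) t) = passComul q g (O t) := by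
    rw [passComul_eq]
    cases g <;> simp only [comulGen, map_add, map_smul, LinearMap.add_apply, LinearMap.smul_apply,
      μ_tmul_apply, ← of_a, ← of_b, ← of_c, ← of_d, hA, hL]
  simp only [LinearMap.comp_apply,
    show comul1 ℂ (comul q) (x ⊗ₜ y) = TensorProduct.assoc ℂ _ _ _ (comul q x ⊗ₜ y) from rfl]
  rw [O_tmul]
  induction x using induction_left with
  | one => simp [comul_one, O, ψ_one_tmul, leg12_tmul, comul2]
  | add x y hx hy => simp only [map_add, add_tmul, hx, hy]
  | smul r x hx => simp only [map_smul, ← smul_tmul', hx]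
  | mul g x hx => rw [ψ_mul_tmul, comul2_L, comul_mul, comul_of, key, hx]

theorem comul2_A (g : Gen) (t : Alg q ⊗[ℂ] Alg q) :
    comul2 ℂ (comul q) (A q (of q g) t) = mulFirst q g (comul2 ℂ (comul q) t) := by
  induction t with
  | zero => simp
  | add s t hs ht => simp only [map_add, hs, ht]
  | tmul v w => simp [A_tmul, comul2]

theorem assoc_A (g : Gen) (t : Alg q ⊗[ℂ] Alg q) (z : Alg q) :
    TensorProduct.assoc ℂ _ _ _ (A q (of q g) t ⊗ₜ z) =
      mulFirst q g (TensorProduct.assoc ℂ _ _ _ (t ⊗ₜ z)) := by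
  induction t with
  | zero => simp
  | add s t hs ht => simp only [map_add, add_tmul, hs, ht]
  | tmul v w => simp [A_tmul]

theorem assoc_L (g : Gen) (t : Alg q ⊗[ℂ] Alg q) (z : Alg q) :
    TensorProduct.assoc ℂ _ _ _ (L (of q g) t ⊗ₜ z) =
      passA q g (TensorProduct.assoc ℂ _ _ _ (t ⊗ₜ z)) := by
  induction t with
  | zero => simp
  | add s t hs ht => simp only [map_add, add_tmul, hs, ht]
  | tmul v w => cases g <;> simp [pass_a_tmul, pass_b_tmul, pass_c_tmul, pass_d_tmul, of_a, of_b,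
      of_c, of_d, L_a_tmul, L_b_tmul, L_c_tmul, L_d_tmul, A_tmul, add_tmul, sub_tmul, ← smul_tmul']

theorem comul1_A (g : Gen) (t : Alg q ⊗[ℂ] Alg q) :
    comul1 ℂ (comul q) (A q (of q g) t) = match g with
  | .a => mulFirst q .a (passA q .a (comul1 ℂ (comul q) t)) +
      q ^ 4 • mulFirst q .c (passA q .b (comul1 ℂ (comul q) t))
  | .b => (1 - q ^ 2) • mulFirst q .a (passA q .b (comul1 ℂ (comul q) t)) +
      mulFirst q .b (passA q .a (comul1 ℂ (comul q) t)) +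
      q ^ 2 • mulFirst q .d (passA q .b (comul1 ℂ (comul q) t))
  | .c => (1 - q ^ 2) • mulFirst q .c (passA q .a (comul1 ℂ (comul q) t)) +
      mulFirst q .a (passA q .c (comul1 ℂ (comul q) t)) +
      q ^ 2 • mulFirst q .c (passA q .d (comul1 ℂ (comul q) t))
  | .d => (q ^ 2 - 1) • mulFirst q .a (passA q .a (comul1 ℂ (comul q) t)) +
      (q ^ 4 - q ^ 2) • mulFirst q .c (passA q .b (comul1 ℂ (comul q) t)) +
      q ^ 2 • mulFirst q .b (passA q .c (comul1 ℂ (comul q) t)) +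
      (1 - q ^ 2) • mulFirst q .a (passA q .d (comul1 ℂ (comul q) t)) +
      (1 - q ^ 2) • mulFirst q .d (passA q .a (comul1 ℂ (comul q) t)) +
      q ^ 2 • mulFirst q .d (passA q .d (comul1 ℂ (comul q) t)) := by
  induction t with
  | zero => cases g <;> simp
  | add s t hs ht => cases g <;> simp only [map_add, hs, ht] <;> module
  | tmul v w =>
    have h (x : Alg q) : comul1 ℂ (comul q) (x ⊗ₜ w) =
      TensorProduct.assoc ℂ _ _ _ (comul q x ⊗ₜ w) := rfl
    rw [A_tmul, h, h, comul_mul, comul_of]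
    cases g <;> simp only [comulGen, map_add, map_smul, LinearMap.add_apply, LinearMap.smul_apply,
      μ_tmul_apply, add_tmul, ← smul_tmul', ← of_a, ← of_b, ← of_c, ← of_d, assoc_A, assoc_L]

/-- Multiplication by the coproduct of a generator in the braided tensor square is a combination of
products `A · L`. Under both `Δ ⊗ id` and `id ⊗ Δ` these become the same combination of
products `mulFirst · passA · passL`. -/
theorem coassoc (x : Alg q) : comul1 ℂ (comul q) (comul q x) = comul2 ℂ (comul q) (comul q x) := by
  induction x using induction_left with
  | one => simp [comul_one, comul1, comul2]
  | add x y hx hy => simp only [map_add, hx, hy]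
  | smul r x hx => simp only [map_smul, hx]
  | mul g x hx =>
    rw [comul_mul, comul_of]
    cases g <;> simp only [comulGen, map_add, map_smul, LinearMap.add_apply, LinearMap.smul_apply,
      μ_tmul_apply, ← of_a, ← of_b, ← of_c, ← of_d, comul1_A, comul2_A, comul1_L, comul2_L, hx,
      passComul_eq] <;> module

end coalgebra

/-! ### The antipode laws -/

section antipode

variable {q : ℂ} [NeZero q]
open TensorProduct LinearMap

theorem S_comp_mulGen (g : Gen) (x : Alg q) : S q (mulGen q g x) = C q (S q (of q g)) (S q x) :=
  S_mul _ _

theorem ψ_antipode_right : ψ ∘ₗ (S q).lTensor (Alg q) = (S q).rTensor (Alg q) ∘ₗ ψ := by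
  refine TensorProduct.ext' fun x y ↦ ?_
  simp only [LinearMap.comp_apply, lTensor_tmul]
  induction x using induction_left with
  | one => simp [ψ_one_tmul]
  | add x y hx hy => simp only [map_add, add_tmul, hx, hy]
  | smul r x hx => simp only [map_smul, ← smul_tmul', hx]
  | mul g x hx =>
    rw [ψ_mul_tmul, ψ_mul_tmul, hx, L_of, isBorelHom_S.pass_rTensor]

/-- A generator crosses a third factor after multiplying by `m ψ`, or crosses it first and
multiplies afterwards; the second form uses that `ψ` commutes with the action. -/
theorem ψ_C_of_tmul (g : Gen) (x y : Alg q) : ψ (C q (of q g) x ⊗ₜ y) =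
    pass q (borelB q) (fun g ↦ C q (of q g)) g (ψ (x ⊗ₜ y)) := by
  have hq := NeZero.ne q
  have hk := isBorelHom_ψ.k (x ⊗ₜ[ℂ] y)
  have hx := isBorelHom_ψ.x (x ⊗ₜ[ℂ] y)
  have hk' := isBorelHom_ψ.k' (x ⊗ₜ[ℂ] y)
  have hkx := isBorelHom_ψ.k' ((borelBB q).x (x ⊗ₜ[ℂ] y))
  have hkxx := isBorelHom_ψ.k' ((borelBB q).x ((borelBB q).x (x ⊗ₜ[ℂ] y)))
  simp only [isBorelHom_ψ.x] at hkx hkxx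
  have key (t : Alg q ⊗[ℂ] Alg q) : pass q (borelB q) (fun g ↦ C q (of q g)) g t = match g with
    | .a => t * 1 ⊗ₜ a q + (borelBB q).x t * 1 ⊗ₜ b q
    | .b => (borelBB q).k t * 1 ⊗ₜ b q
    | .c => (borelBB q).k' t * 1 ⊗ₜ c q + (borelBB q).k' ((borelBB q).x t) * 1 ⊗ₜ d q -
        (borelBB q).k' ((borelBB q).x t) * 1 ⊗ₜ a q -
        (borelBB q).k' ((borelBB q).x ((borelBB q).x t)) * 1 ⊗ₜ b q
    | .d => t * 1 ⊗ₜ d q - (q ^ 2)⁻¹ • ((borelBB q).x t * 1 ⊗ₜ b q) := by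
    induction t with
    | zero => cases g <;> simp
    | add s t hs ht => cases g <;> simp only [map_add, hs, ht, add_mul] <;> module
    | tmul v w =>
      cases g <;> simp [pass_a_tmul, pass_b_tmul, pass_c_tmul, pass_d_tmul, of_a, of_b,
        of_c, of_d, C_a, C_b, C_c, C_d, tmul_add, tmul_sub, add_mul, ← smul_tmul'] <;>
      (match_scalars <;> field_simp <;> ring)
  rw [key]
  cases g <;> dsimp only <;> first | rw [← hkxx, ← hkx, ← hk'] | simp only [← hk, ← hx]
  all_goals
  simp [of_a, of_b, of_c, of_d, C_a, C_b, C_c, C_d, add_tmul, sub_tmul, ← smul_tmul',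
    ψ_mul_tmul, ← L_tmul, add_mul, sub_mul, ψ_tmul (a q), ψ_tmul (b q), ψ_tmul (c q), ψ_tmul (d q),
    L_a_tmul, L_b_tmul, L_c_tmul, L_d_tmul] <;>
  (match_scalars <;> field_simp <;> ring)

theorem ψ_C_S_of_tmul (g : Gen) (x y : Alg q) : ψ (C q (S q (of q g)) x ⊗ₜ y) =
    pass q (borelB q) (fun g ↦ C q (S q (of q g))) g (ψ (x ⊗ₜ y)) := by
  have hq := NeZero.ne q
  have ha := ψ_C_of_tmul .a x y
  have hb := ψ_C_of_tmul .b x y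
  have hc := ψ_C_of_tmul .c x y
  have hd := ψ_C_of_tmul .d x y
  rw [of_a] at ha
  rw [of_b] at hb
  rw [of_c] at hc
  rw [of_d] at hd
  cases g <;> simp only [of_a, of_b, of_c, of_d, S_a, S_b, S_c, S_d, map_add, map_smul, map_neg,
    add_tmul, neg_tmul, ← smul_tmul', ha, hb, hc, hd, LinearMap.add_apply, LinearMap.neg_apply,
    LinearMap.smul_apply] <;>
  induction ψ (x ⊗ₜ[ℂ] y) with
  | zero => simp
  | add s t hs ht => simp only [map_add, smul_add, neg_add, ← hs, ← ht]; try abel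
  | tmul v w =>
    simp [pass_a_tmul, pass_b_tmul, pass_c_tmul, pass_d_tmul, of_a, of_b, of_c, of_d, tmul_add,
      tmul_sub, tmul_neg, ← smul_tmul'] <;>
    (match_scalars <;> field_simp <;> ring)

theorem ψ_antipode_left : ψ ∘ₗ (S q).rTensor (Alg q) = (S q).lTensor (Alg q) ∘ₗ ψ := by
  refine TensorProduct.ext' fun x y ↦ ?_
  simp only [LinearMap.comp_apply, rTensor_tmul]
  induction x using induction_left with
  | one => simp [ψ_one_tmul, S_one]
  | add x y hx hy => simp only [map_add, add_tmul, hx, hy]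
  | smul r x hx => simp only [map_smul, ← smul_tmul', hx]
  | mul g x hx =>
    rw [S_mul, ψ_C_S_of_tmul, hx, ψ_mul_tmul, L_of, pass_lTensor S_comp_mulGen]

theorem L_rTensor_S (x : Alg q) (t : Alg q ⊗[ℂ] Alg q) :
    (S q).rTensor _ (L x t) = L x ((S q).rTensor _ t) := by
  induction t with
  | zero => simp
  | add s t hs ht => simp only [map_add, hs, ht]
  | tmul y z =>
    rw [L_tmul, rTensor_tmul, L_tmul, show ψ (x ⊗ₜ S q y) = (S q).rTensor _ (ψ (x ⊗ₜ y)) from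
      LinearMap.congr_fun ψ_antipode_right (x ⊗ₜ y)]
    induction ψ (x ⊗ₜ[ℂ] y) with
    | zero => simp
    | add s t hs ht => simp only [map_add, add_mul, hs, ht]
    | tmul v w => simp

theorem mul'_mul_right (t : Alg q ⊗[ℂ] Alg q) (z : Alg q) :
    LinearMap.mul' ℂ _ (t * 1 ⊗ₜ z) = LinearMap.mul' ℂ _ t * z := by
  induction t with
  | zero => simp
  | add s t hs ht => simp only [map_add, add_mul, hs, ht]
  | tmul v w => simp [mul_assoc]

theorem mul'_braidedMulRight (z : Alg q) (t : Alg q ⊗[ℂ] Alg q) :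
    LinearMap.mul' ℂ _ (braidedMulRight z t) =
      LinearMap.mul' ℂ _ ((C q).flip z |>.lTensor _ t) := by
  induction t with
  | zero => simp
  | add s t hs ht => simp only [map_add, hs, ht]
  | tmul v w =>
    rw [braidedMulRight_tmul, lTensor_tmul, flip_apply, C_apply]
    induction ψ (w ⊗ₜ[ℂ] z) with
    | zero => simp
    | add s t hs ht => simp only [map_add, mul_add, hs, ht, tmul_add]
    | tmul v w => simp [mul_assoc]

/-- With `N = m (S ⊗ id)`, one has `N (s t) = m (L (N s) ((S ⊗ id) t))` in the braided tensor
square. If `N s` is a scalar, then `N (s t) = N s · N t`. -/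
theorem mul'_rTensor_S_μ (s t : Alg q ⊗[ℂ] Alg q) :
    LinearMap.mul' ℂ _ ((S q).rTensor _ (μ q s t)) = LinearMap.mul' ℂ _
      (L (LinearMap.mul' ℂ _ ((S q).rTensor _ s)) ((S q).rTensor _ t)) := by
  have key (x : Alg q) (t : Alg q ⊗[ℂ] Alg q) : LinearMap.mul' ℂ _ ((S q).rTensor _ (A q x t)) =
      LinearMap.mul' ℂ _ (L (S q x) ((S q).rTensor _ t)) := by
    induction t with
    | zero => simp
    | add s t hs ht => simp only [map_add, hs, ht]
    | tmul v w =>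
      rw [A_tmul, rTensor_tmul, rTensor_tmul, L_tmul, mul'_mul_right, S_mul, C_apply]; simp
  induction s with
  | zero => simp
  | add s s' hs hs' => simp only [map_add, LinearMap.add_apply, hs, hs']
  | tmul x y =>
    rw [μ_tmul_apply, key, L_rTensor_S, ← L_mul_apply]; simp

theorem mul'_lTensor_S_L (x : Alg q) (t : Alg q ⊗[ℂ] Alg q) :
    LinearMap.mul' ℂ _ ((S q).lTensor _ (L x t)) =
      C q (S q x) (LinearMap.mul' ℂ _ ((S q).lTensor _ t)) := by
  induction t with
  | zero => simp
  | add s t hs ht => simp only [map_add, hs, ht]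
  | tmul y z =>
    have e := LinearMap.congr_fun ψ_antipode_left (x ⊗ₜ[ℂ] y)
    simp only [LinearMap.comp_apply, rTensor_tmul] at e
    rw [L_tmul, lTensor_tmul, mul'_apply, C_apply, ψ_tmul_mul, e, mul'_braidedMulRight]
    congr 1
    induction ψ (x ⊗ₜ[ℂ] y) with
    | zero => simp
    | add s t hs ht => simp only [map_add, add_mul, hs, ht]
    | tmul v w => simp [S_mul]

theorem antipode_left_apply (x : Alg q) :
    LinearMap.mul' ℂ _ ((S q).rTensor _ (comul q x)) = algebraMap ℂ _ (counit q x) := by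
  induction x using induction_left with
  | one => simp [comul_one, S_one]
  | add x y hx hy => simp only [map_add, hx, hy]
  | smul r x hx =>
    rw [map_smul, map_smul, map_smul, hx, map_smul, smul_eq_mul, map_mul, Algebra.smul_def]
  | mul g x hx =>
    have h := isBSL q
    have hq := NeZero.ne q
    have hg : LinearMap.mul' ℂ _ ((S q).rTensor _ (comulGen q g)) =
        algebraMap ℂ _ (counit q (of q g)) := by
      cases g <;> simp [comulGen, of_a, of_b, of_c, of_d, add_mul, h.ba, h.ca, ← h.ad, h.bc',
        h.cb, h.db, h.cd', smul_add, smul_sub] <;>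
      (match_scalars <;> field_simp <;> ring)
    rw [comul_mul, comul_of, mul'_rTensor_S_μ, hg, AlgHom.commutes, Module.algebraMap_end_apply,
      map_smul, hx, map_mul (counit q), map_mul, Algebra.smul_def]

theorem antipode_right_apply (x : Alg q) :
    LinearMap.mul' ℂ _ ((S q).lTensor _ (comul q x)) = algebraMap ℂ _ (counit q x) := by
  induction x using induction_left with
  | one => simp [comul_one, S_one]
  | add x y hx hy => simp only [map_add, hx, hy]
  | smul r x hx =>
    rw [map_smul, map_smul, map_smul, hx, map_smul, smul_eq_mul, map_mul, Algebra.smul_def]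
  | mul g x hx =>
    have h := isBSL q
    have hq := NeZero.ne q
    have hA (x : Alg q) (t : Alg q ⊗[ℂ] Alg q) : LinearMap.mul' ℂ _ ((S q).lTensor _ (A q x t)) =
        x * LinearMap.mul' ℂ _ ((S q).lTensor _ t) := by
      induction t with
      | zero => simp
      | add s t hs ht => simp only [map_add, hs, ht, mul_add]
      | tmul v w => simp [A_tmul, mul_assoc]
    have hμ (s : Alg q ⊗[ℂ] Alg q) : LinearMap.mul' ℂ _ ((S q).lTensor _ (μ q s (comul q x))) =
        counit q x • LinearMap.mul' ℂ _ ((S q).lTensor _ s) := by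
      induction s with
      | zero => simp
      | add s s' hs hs' => simp only [map_add, LinearMap.add_apply, hs, hs', smul_add]
      | tmul y z =>
        rw [μ_tmul_apply, hA, mul'_lTensor_S_L, hx, Algebra.algebraMap_eq_smul_one, map_smul,
          C_apply_one]
        simp
    have hg : LinearMap.mul' ℂ _ ((S q).lTensor _ (comulGen q g)) =
        algebraMap ℂ _ (counit q (of q g)) := by
      cases g <;> simp [comulGen, of_a, of_b, of_c, of_d, mul_add, h.ba, h.ca, ← h.ad, h.bc',
        h.cb, h.db, h.cd', smul_add, smul_sub] <;>
      (match_scalars <;> field_simp <;> ring)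
    rw [comul_mul, comul_of, hμ, hg, map_mul (counit q), map_mul, Algebra.smul_def,
      Algebra.commutes]

instance : Coalgebra ℂ (Alg q) where
  comul := comul q
  counit := (counit q).toLinearMap
  coassoc := LinearMap.ext coassoc
  rTensor_counit_comp_comul := LinearMap.ext rTensor_counit_comul
  lTensor_counit_comp_comul := LinearMap.ext lTensor_counit_comul

end antipode

/-! ### The coproduct of an antipode -/

section antiComul

variable {q : ℂ} [NeZero q]
open TensorProduct LinearMap

theorem μ_S_ψ (x y z w : Alg q) : μ q (map (S q) (S q) (ψ (x ⊗ₜ y))) (z ⊗ₜ w) =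
    ψ (S q x ⊗ₜ (S q y * z)) * 1 ⊗ₜ w := by
  have e : map (S q) (S q) (ψ (x ⊗ₜ y)) = ψ (S q x ⊗ₜ S q y) := by
    have h₁ := LinearMap.congr_fun ψ_antipode_left (x ⊗ₜ[ℂ] S q y)
    have h₂ := LinearMap.congr_fun ψ_antipode_right (x ⊗ₜ[ℂ] y)
    simp only [LinearMap.comp_apply, rTensor_tmul, lTensor_tmul] at h₁ h₂
    rw [h₁, h₂, ← LinearMap.comp_apply (lTensor _ _), lTensor_comp_rTensor]
  rw [μ_apply_tmul, e, ψ_tmul_mul]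

/-- The map `(S ⊗ S) ψ Δ`, which is shown to be `Δ ∘ S`. -/
def antiComul : Alg q →ₗ[ℂ] Alg q ⊗[ℂ] Alg q := map (S q) (S q) ∘ₗ ψ ∘ₗ comul q

/-- In the braided tensor square, `(S ⊗ S) ψ Δ` is a left convolution inverse of `Δ`. -/
theorem antiComul_mul_comul (x : Alg q) :
    TensorProduct.lift (((μ q).compl₂ (comul q)) ∘ₗ antiComul) (comul q x) =
      counit q x • 1 ⊗ₜ 1 := by
  -- `W` evaluates `x ⊗ y ⊗ z` to `(S ⊗ S) ψ(x ⊗ y) · Δ(z)`. By coassociativity the two inner legs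
  -- can be contracted first, which leaves `m (S ⊗ id) Δ`.
  let F : Alg q ⊗[ℂ] Alg q →ₗ[ℂ] Module.End ℂ (Alg q ⊗[ℂ] Alg q) := μ q ∘ₗ map (S q) (S q) ∘ₗ ψ
  let V (x : Alg q) : Alg q ⊗[ℂ] (Alg q ⊗[ℂ] Alg q) →ₗ[ℂ] Alg q ⊗[ℂ] Alg q :=
    TensorProduct.lift (F ∘ₗ TensorProduct.mk ℂ _ _ x)
  let W : Alg q ⊗[ℂ] (Alg q ⊗[ℂ] Alg q) →ₗ[ℂ] Alg q ⊗[ℂ] Alg q :=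
    TensorProduct.lift F ∘ₗ (comul q).lTensor _ ∘ₗ (TensorProduct.assoc ℂ _ _ _).symm.toLinearMap
  have hV (x z : Alg q) (s : Alg q ⊗[ℂ] Alg q) : V x (TensorProduct.assoc ℂ _ _ _ (s ⊗ₜ z)) =
      ψ (S q x ⊗ₜ LinearMap.mul' ℂ _ ((S q).rTensor _ s)) * 1 ⊗ₜ z := by
    induction s with
    | zero => simp
    | add s t hs ht => simp only [map_add, add_tmul, tmul_add, add_mul, hs, ht]
    | tmul y w => exact μ_S_ψ x y w z
  have hV' (x : Alg q) (s : Alg q ⊗[ℂ] Alg q) : V x (comul1 ℂ (comul q) s) =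
      1 ⊗ₜ (S q x * TensorProduct.lid ℂ _ ((counit q).toLinearMap.rTensor _ s)) := by
    induction s with
    | zero => simp
    | add s t hs ht => simp only [map_add, tmul_add, mul_add, hs, ht]
    | tmul y z =>
      rw [show comul1 ℂ (comul q) (y ⊗ₜ z) = TensorProduct.assoc ℂ _ _ _ (comul q y ⊗ₜ z) from rfl,
        hV, antipode_left_apply, Algebra.algebraMap_eq_smul_one, tmul_smul, map_smul, ψ_tmul_one]
      simp
  have hW (x : Alg q) (s : Alg q ⊗[ℂ] Alg q) : W (x ⊗ₜ s) = V x (comul2 ℂ (comul q) s) := by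
    induction s with
    | zero => simp
    | add s t hs ht => simp only [map_add, tmul_add, hs, ht]
    | tmul y z => rfl
  have hW₂ (s : Alg q ⊗[ℂ] Alg q) : W (comul2 ℂ (comul q) s) =
      1 ⊗ₜ LinearMap.mul' ℂ _ ((S q).rTensor _ s) := by
    induction s with
    | zero => simp
    | add s t hs ht => simp only [map_add, tmul_add, hs, ht]
    | tmul x y =>
      rw [show comul2 ℂ (comul q) (x ⊗ₜ y) = x ⊗ₜ comul q y from rfl, hW, ← coassoc, hV',
        rTensor_counit_comul]
      simp
  have hW₁ (s : Alg q ⊗[ℂ] Alg q) : W (comul1 ℂ (comul q) s) =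
      TensorProduct.lift (((μ q).compl₂ (comul q)) ∘ₗ antiComul) s := by
    induction s with
    | zero => simp
    | add s t hs ht => simp only [map_add, hs, ht]
    | tmul x y => simp [W, comul1, F, antiComul]
  rw [← hW₁, coassoc, hW₂, antipode_left_apply, Algebra.algebraMap_eq_smul_one, tmul_smul]

open WithConv in
/-- In the convolution algebra of maps into `End (B ⊗ B)`, both sides are inverse to `Δ`, one on
each side. -/
theorem comul_antipode : comul q ∘ₗ S q = map (S q) (S q) ∘ₗ ψ ∘ₗ comul q := by
  let f : WithConv (Alg q →ₗ[ℂ] Module.End ℂ (Alg q ⊗[ℂ] Alg q)) := toConv (μ q ∘ₗ comul q)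
  let g : WithConv (Alg q →ₗ[ℂ] Module.End ℂ (Alg q ⊗[ℂ] Alg q)) :=
    toConv (μ q ∘ₗ comul q ∘ₗ S q)
  let h : WithConv (Alg q →ₗ[ℂ] Module.End ℂ (Alg q ⊗[ℂ] Alg q)) := toConv (μ q ∘ₗ antiComul)
  have hfg : f * g = 1 := by
    ext x : 2
    have (t : Alg q ⊗[ℂ] Alg q) : LinearMap.mul' ℂ _ (map f.ofConv g.ofConv t) =
        μ q (comul q (LinearMap.mul' ℂ _ ((S q).lTensor _ t))) := by
      induction t with
      | zero => simp
      | add s t hs ht => simp only [map_add, hs, ht]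
      | tmul x y => simp [f, g, μ_mul_μ, comul_mul]
    rw [LinearMap.convMul_apply, LinearMap.convOne_apply]
    refine (this (comul q x)).trans ?_
    rw [antipode_right_apply, Algebra.algebraMap_eq_smul_one, map_smul, map_smul, comul_one, μ_one,
      Algebra.algebraMap_eq_smul_one]
    rfl
  have hhf : h * f = 1 := by
    ext x : 2
    have (t : Alg q ⊗[ℂ] Alg q) : LinearMap.mul' ℂ _ (map h.ofConv f.ofConv t) =
        μ q (TensorProduct.lift (((μ q).compl₂ (comul q)) ∘ₗ antiComul) t) := by
      induction t with
      | zero => simp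
      | add s t hs ht => simp only [map_add, hs, ht]
      | tmul x y => simp [f, h, μ_mul_μ]
    rw [LinearMap.convMul_apply, LinearMap.convOne_apply]
    refine (this (comul q x)).trans ?_
    rw [antiComul_mul_comul, map_smul, μ_one, Algebra.algebraMap_eq_smul_one]
    rfl
  have key : h = g := left_inv_eq_right_inv
    (M := WithConv (Alg q →ₗ[ℂ] Module.End ℂ (Alg q ⊗[ℂ] Alg q))) hhf hfg
  ext x
  have := congrArg (fun F : WithConv (Alg q →ₗ[ℂ] Module.End ℂ (Alg q ⊗[ℂ] Alg q)) ↦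
    F.ofConv x (1 ⊗ₜ 1)) key
  simpa [h, g, μ_apply_one, antiComul] using this.symm

variable (q) in
/-- The braided Hopf algebra structure. -/
def braidedHopfAlgebra : BraidedHopfAlgebra ℂ (Alg q) where
  S := S q
  ψ := ψ
  ψ_bijective := ψ_bijective
  yang_baxter := yang_baxter
  ψ_mul_left := ψ_mul_left
  ψ_mul_right := ψ_mul_right
  ψ_one_left := ψ_one_tmul
  ψ_one_right := ψ_tmul_one
  ψ_comul_left := ψ_comul_left
  ψ_comul_right := ψ_comul_right
  ψ_counit_left := ψ_counit_left
  ψ_counit_right := ψ_counit_right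
  ψ_antipode_left := ψ_antipode_left
  ψ_antipode_right := ψ_antipode_right
  comul_mul := TensorProduct.ext' fun x y ↦
    (comul_mul x y).trans (braidedMul_tmul _ _).symm
  comul_one := comul_one
  counit_mul := map_mul (counit q)
  counit_one := map_one (counit q)
  antipode_left := LinearMap.ext antipode_left_apply
  antipode_right := LinearMap.ext antipode_right_apply
  antipode_mul := TensorProduct.ext' S_mul
  comul_antipode := comul_antipode

end antiComul

/-! ### The involution for real parameter -/

section involution

variable {q : ℂ}
open TensorProduct LinearMap MulOpposite

/-- The opposite algebra with the conjugate scalars. An algebra map into it is an antilinear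
antimultiplicative map. -/
def ConjOp (q : ℂ) : Type := (Alg q)ᵐᵒᵖ

instance : Ring (ConjOp q) := inferInstanceAs (Ring (Alg q)ᵐᵒᵖ)
instance : Algebra ℂ (ConjOp q) := RingHom.toAlgebra'
  ((algebraMap ℂ (Alg q)ᵐᵒᵖ).comp (starRingEnd ℂ)) fun r x ↦
    Algebra.commutes (A := (Alg q)ᵐᵒᵖ) (starRingEnd ℂ r) x

/-- The identity map to `ConjOp q`. -/
def toConjOp : Alg q ≃+ ConjOp q := opAddEquiv

theorem toConjOp_mul (x y : Alg q) : toConjOp (x * y) = toConjOp y * toConjOp x := rfl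
theorem toConjOp_one : toConjOp (1 : Alg q) = 1 := rfl
theorem toConjOp_smul (r : ℂ) (x : Alg q) :
    toConjOp (r • x) = starRingEnd ℂ r • toConjOp x := by
  change op (r • x) = op (algebraMap ℂ (Alg q) (starRingEnd ℂ (starRingEnd ℂ r))) * op x
  rw [Complex.conj_conj, ← op_mul, ← Algebra.commutes, Algebra.smul_def]

theorem conjOp_isBSL [NeZero q] (hq : starRingEnd ℂ q = q) : IsBSL q (toConjOp (a q))
    (toConjOp (c q)) (toConjOp (b q)) (toConjOp (d q)) := by
  have h := isBSL q
  have hs (r : ℂ) (hr : starRingEnd ℂ r = r) (x : Alg q) : r • toConjOp x = toConjOp (r • x) := by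
    rw [toConjOp_smul, hr]
  have h₁ := hs (q ^ 2) (by simp [hq])
  have h₂ := hs (q ^ 2)⁻¹ (by simp [hq])
  have h₃ := hs (1 - (q ^ 2)⁻¹) (by simp [hq])
  constructor <;> simp only [← toConjOp_mul, h₁, h₂, h₃, ← map_sub, ← map_add, ← toConjOp_one] <;>
    refine congrArg toConjOp ?_
  · rw [h.ca, smul_inv_smul₀ (q_sq_ne_zero q)]
  · rw [h.ba, inv_smul_smul₀ (q_sq_ne_zero q)]
  · exact h.ad.symm
  · rw [h.bc, mul_sub, sub_mul, h.ad]
  · exact h.cd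
  · exact h.db
  · rw [← h.ad, h.det]

variable [NeZero q]

/-- The involution for real `q`, which exchanges `b` and `c` and fixes `a` and `d`. -/
def star (hq : starRingEnd ℂ q = q) : Alg q →ₛₗ[starRingEnd ℂ] Alg q where
  toFun x := toConjOp.symm (lift (conjOp_isBSL hq) x)
  map_add' x y := by simp
  map_smul' r x := by
    rw [map_smul, AddEquiv.symm_apply_eq, toConjOp_smul, Complex.conj_conj,
      AddEquiv.apply_symm_apply]

section star

variable (hq : starRingEnd ℂ q = q)

theorem star_apply (x : Alg q) : star hq x = toConjOp.symm (lift (conjOp_isBSL hq) x) := rfl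

@[simp] theorem star_a : star hq (a q) = a q := by simp [star_apply]
@[simp] theorem star_b : star hq (b q) = c q := by simp [star_apply]
@[simp] theorem star_c : star hq (c q) = b q := by simp [star_apply]
@[simp] theorem star_d : star hq (d q) = d q := by simp [star_apply]

theorem star_one : star hq 1 = 1 := by
  rw [star_apply, map_one, AddEquiv.symm_apply_eq, toConjOp_one]

theorem star_mul (x y : Alg q) : star hq (x * y) = star hq y * star hq x := by
  rw [star_apply, map_mul, AddEquiv.symm_apply_eq, toConjOp_mul]
  simp [star_apply]

theorem star_star (x : Alg q) : star hq (star hq x) = x := by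
  induction x using induction_left with
  | one => simp [star_one]
  | add x y hx hy => simp only [map_add, hx, hy]
  | smul r x hx => simp only [map_smulₛₗ, hx, Complex.conj_conj]
  | mul g x hx => cases g <;> simp [star_mul, hx, of_a, of_b, of_c, of_d]

local notation "τ" => tensorInvol (star hq)

@[simp] theorem tensorInvol_tmul (x y : Alg q) : τ (x ⊗ₜ y) = star hq y ⊗ₜ star hq x := rfl

theorem tensorInvol_tensorInvol (t : Alg q ⊗[ℂ] Alg q) : τ (τ t) = t := by
  induction t with
  | zero => simp
  | add s t hs ht => simp only [map_add, hs, ht]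
  | tmul x y => simp [star_star]

theorem tensorInvol_mul (s t : Alg q ⊗[ℂ] Alg q) : τ (s * t) = τ t * τ s := by
  induction s with
  | zero => simp
  | add s s' hs hs' => simp only [map_add, add_mul, mul_add, hs, hs']
  | tmul x y =>
    induction t with
    | zero => simp
    | add s t hs ht => simp only [map_add, add_mul, mul_add, hs, ht]
    | tmul z w => simp [star_mul]

/-- For real `q`, conjugation by the involution fixes the table of values of `ψ` on generators. -/
theorem tensorInvol_ψ_of_of (g h : Gen) :
    τ (ψ (star hq (of q h) ⊗ₜ star hq (of q g))) = ψ (of q g ⊗ₜ of q h) := by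
  have hq' := NeZero.ne q
  cases g <;> cases h <;> simp [of_a, of_b, of_c, of_d, ψ_tmul, L_a_tmul, L_b_tmul, L_c_tmul,
    L_d_tmul, hq, tmul_sub, sub_tmul, ← smul_tmul', smul_sub] <;>
  (match_scalars <;> field_simp <;> ring)

theorem tensorInvol_ψ_of_tmul (g : Gen) (x : Alg q) :
    τ (ψ (star hq x ⊗ₜ star hq (of q g))) = ψ (of q g ⊗ₜ x) := by
  induction x using induction_right with
  | one => simp [star_one, ψ_one_tmul, ψ_tmul_one, star_star]
  | add x y hx hy => simp only [map_add, add_tmul, tmul_add, hx, hy]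
  | smul r x hx => simp only [map_smulₛₗ, tmul_smul, ← smul_tmul', hx,
    Complex.conj_conj, RingHom.id_apply]
  | mul h x hx =>
    have key (y : Alg q) (g : Gen) :
        τ (L (star hq (of q h)) (τ (y ⊗ₜ of q g))) = braidedMulRight (of q h) (y ⊗ₜ of q g) := by
      rw [tensorInvol_tmul, L_tmul, tensorInvol_mul, tensorInvol_ψ_of_of, braidedMulRight_tmul]
      simp [star_star, star_one]
    have ha (y : Alg q) := key y .a
    have hb (y : Alg q) := key y .b
    have hc (y : Alg q) := key y .c
    have hd (y : Alg q) := key y .d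
    simp only [of_a, of_b, of_c, of_d] at ha hb hc hd
    rw [star_mul, ψ_mul_tmul, ψ_tmul_mul, ← tensorInvol_tensorInvol hq (ψ _), hx, ψ_tmul]
    cases g <;> simp only [of_a, of_b, of_c, of_d, L_a_tmul, L_b_tmul, L_c_tmul, L_d_tmul, mul_one,
      map_add, map_sub, map_smul, ← smul_tmul', ha, hb, hc, hd]
    simp only [map_smulₛₗ, RingHom.id_apply, map_inv₀, map_pow, hq, hb]

/-- Conjugation by the involution exchanges the two hexagons. The rule for right factors extends the
agreement on generators to `tensorInvol_ψ_of_tmul`, and the rule for left factors extends that to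
all elements. -/
theorem tensorInvol_ψ_tmul (x y : Alg q) :
    τ (ψ (star hq y ⊗ₜ star hq x)) = ψ (x ⊗ₜ y) := by
  induction x using induction_left with
  | one => simp [star_one, ψ_one_tmul, ψ_tmul_one, star_star]
  | add x y hx hy => simp only [map_add, add_tmul, tmul_add, hx, hy]
  | smul r x hx => simp only [map_smulₛₗ, tmul_smul, ← smul_tmul', hx,
    Complex.conj_conj, RingHom.id_apply]
  | mul g x hx =>
    have key (t : Alg q ⊗[ℂ] Alg q) :
        τ (braidedMulRight (star hq (of q g)) (τ t)) = L (of q g) t := by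
      induction t with
      | zero => simp
      | add s t hs ht => simp only [map_add, hs, ht]
      | tmul y z =>
        rw [tensorInvol_tmul, braidedMulRight_tmul, tensorInvol_mul, tensorInvol_ψ_of_tmul, L_tmul]
        simp [star_star, star_one]
    rw [star_mul, ψ_tmul_mul, ψ_mul_tmul, ← hx, ← key, tensorInvol_tensorInvol]

theorem ψ_tensorInvol (t : Alg q ⊗[ℂ] Alg q) : ψ (τ t) = τ (ψ t) := by
  induction t with
  | zero => simp
  | add s t hs ht => simp only [map_add, hs, ht]
  | tmul x y => rw [← tensorInvol_ψ_tmul hq x y, tensorInvol_tensorInvol, tensorInvol_tmul]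

theorem tensorInvol_μ (s t : Alg q ⊗[ℂ] Alg q) : τ (μ q s t) = μ q (τ t) (τ s) := by
  induction s with
  | zero => simp
  | add s s' hs hs' => simp only [map_add, LinearMap.add_apply, hs, hs']
  | tmul x y =>
    induction t with
    | zero => simp
    | add s t hs ht => simp only [map_add, LinearMap.add_apply, hs, ht]
    | tmul z w =>
      rw [μ_tmul_apply, L_tmul, A_apply, tensorInvol_mul, tensorInvol_mul, ← ψ_tensorInvol]
      simp [μ_tmul_apply, L_tmul, A_apply, star_one, mul_assoc]

theorem comul_star (x : Alg q) : comul q (star hq x) = τ (comul q x) := by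
  induction x using induction_left with
  | one => simp [star_one, comul_one]
  | add x y hx hy => simp only [map_add, hx, hy]
  | smul r x hx => simp only [map_smulₛₗ, hx, RingHom.id_apply]
  | mul g x hx =>
    rw [star_mul, comul_mul, comul_mul, tensorInvol_μ, hx]
    congr 1
    cases g <;> simp [of_a, of_b, of_c, of_d, comul_a, comul_b, comul_c, comul_d, comulGen, hq] <;>
    abel

theorem star_mul' (t : Alg q ⊗[ℂ] Alg q) :
    star hq (LinearMap.mul' ℂ _ t) = LinearMap.mul' ℂ _ (τ t) := by
  induction t with
  | zero => simp
  | add s t hs ht => simp only [map_add, hs, ht]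
  | tmul x y => simp [star_mul]

theorem S_star (x : Alg q) : S q (star hq x) = star hq (S q x) := by
  induction x using induction_left with
  | one => simp [star_one, S_one]
  | add x y hx hy => simp only [map_add, hx, hy]
  | smul r x hx => simp only [map_smulₛₗ, hx, RingHom.id_apply]
  | mul g x hx =>
    have hg : S q (star hq (of q g)) = star hq (S q (of q g)) := by
      cases g <;> simp [of_a, of_b, of_c, of_d, hq]
    rw [star_mul, S_mul, S_mul, C_apply, C_apply, star_mul', ← ψ_tensorInvol, hx, hg]
    rfl

theorem isBraidedInvolution : IsBraidedInvolution (braidedHopfAlgebra q) (star hq) where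
  invol := star_star hq
  antimul := star_mul hq
  comul_star := comul_star hq
  antipode_star := S_star hq
  ψ_star := ψ_tensorInvol hq

end star

end involution

/-! ### Values on generators and the comparison with the matrix coproduct -/

section values

variable {q : ℂ} [NeZero q]
open TensorProduct LinearMap

/-- The character with `a, d ↦ 0` and `c ↦ s`; the determinant relation forces `b ↦ -(q² s)⁻¹`. -/
def character (q : ℂ) [NeZero q] {s : ℂ} (hs : s ≠ 0) : Alg q →ₐ[ℂ] ℂ :=
  lift (α := 0) (β := -(q ^ 2 * s)⁻¹) (γ := s) (δ := 0) <| by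
    have hq := NeZero.ne q
    constructor <;> simp [mul_comm]
    field_simp

/-- The product of two characters on the two legs. -/
def characterPair (q : ℂ) [NeZero q] {s t : ℂ} (hs : s ≠ 0) (ht : t ≠ 0) :
    Alg q ⊗[ℂ] Alg q →ₗ[ℂ] ℂ :=
  LinearMap.mul' ℂ ℂ ∘ₗ map (character q hs).toLinearMap (character q ht).toLinearMap

theorem comul_a_ne : comul q (a q) ≠ a q ⊗ₜ a q + b q ⊗ₜ c q := by
  have hq := NeZero.ne q
  intro h
  have ht : 2 * q ^ 2 ≠ 0 := by simp [hq]
  -- at `s = 1` and `t`, the terms `q⁴ c ⊗ b` and `b ⊗ c` become `-q² t⁻¹` and `-q⁻² t`,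
  -- which differ unless `t ^ 2 = q ^ 4`
  have := congrArg (characterPair q one_ne_zero ht) h
  simp [comul_a, comulGen, characterPair, character] at this
  field_simp at this
  norm_num at this

theorem ψ_a_tmul_a_ne (h : q ^ 2 ≠ 1) :
    ψ (a q ⊗ₜ a q) ≠ a q ⊗ₜ a q + (1 - q ^ 2) • (b q ⊗ₜ c q) := by
  have hq := NeZero.ne q
  intro h'
  -- at `s = 1` and `t = q`, the two sides become `-(q² - 1) q⁻¹` and `(q² - 1) q⁻¹`
  have := congrArg (characterPair q one_ne_zero hq) h'
  simp [ψ_tmul, L_a_tmul, characterPair, character, ← smul_tmul'] at this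
  field_simp at this
  have h₀ : (q ^ 2 - 1) * 2 = 0 := by linear_combination this
  simp [sub_eq_zero, h] at h₀

theorem coproductValues : CoproductValues q (comul q) :=
  ⟨comul_a, comul_b, comul_c, comul_d⟩

theorem counitValues : CounitValues q (counit q).toLinearMap :=
  ⟨counit_a, counit_b, counit_c, counit_d⟩

theorem antipodeValues : AntipodeValues q (S q) := ⟨S_a, S_b, S_c, S_d⟩

theorem ψ_generators :
    ψ (a q ⊗ₜ a q) = a q ⊗ₜ a q + (q ^ 4 - q ^ 2) • (c q ⊗ₜ b q) ∧
    ψ (a q ⊗ₜ b q) = b q ⊗ₜ a q + (1 - q ^ 2) • (a q ⊗ₜ b q) + (q ^ 2 - 1) • (d q ⊗ₜ b q) ∧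
    ψ (a q ⊗ₜ c q) = c q ⊗ₜ a q ∧
    ψ (a q ⊗ₜ d q) = d q ⊗ₜ a q + (1 - q ^ 2) • (c q ⊗ₜ b q) ∧
    ψ (b q ⊗ₜ a q) = a q ⊗ₜ b q ∧
    ψ (b q ⊗ₜ b q) = (q ^ 2)⁻¹ • (b q ⊗ₜ b q) ∧
    ψ (b q ⊗ₜ c q) = q ^ 2 • (c q ⊗ₜ b q) ∧
    ψ (b q ⊗ₜ d q) = d q ⊗ₜ b q ∧
    ψ (c q ⊗ₜ a q) = a q ⊗ₜ c q + (1 - q ^ 2) • (c q ⊗ₜ a q) + (q ^ 2 - 1) • (c q ⊗ₜ d q) ∧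
    ψ (c q ⊗ₜ b q) = (q ^ 2 - 1) • (a q ⊗ₜ a q) + q ^ 2 • (b q ⊗ₜ c q)
      + (q ^ 4 - q ^ 2 + (q ^ 2)⁻¹ - 1) • (c q ⊗ₜ b q) + (1 - q ^ 2) • (a q ⊗ₜ d q)
      + (1 - q ^ 2) • (d q ⊗ₜ a q) + (q ^ 2 - 1) • (d q ⊗ₜ d q) ∧
    ψ (c q ⊗ₜ c q) = (q ^ 2)⁻¹ • (c q ⊗ₜ c q) ∧
    ψ (c q ⊗ₜ d q) = d q ⊗ₜ c q + (1 - (q ^ 2)⁻¹) • (c q ⊗ₜ a q)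
      + ((q ^ 2)⁻¹ - 1) • (c q ⊗ₜ d q) ∧
    ψ (d q ⊗ₜ a q) = a q ⊗ₜ d q + (1 - q ^ 2) • (c q ⊗ₜ b q) ∧
    ψ (d q ⊗ₜ b q) = b q ⊗ₜ d q + (1 - (q ^ 2)⁻¹) • (a q ⊗ₜ b q)
      + ((q ^ 2)⁻¹ - 1) • (d q ⊗ₜ b q) ∧
    ψ (d q ⊗ₜ c q) = c q ⊗ₜ d q ∧
    ψ (d q ⊗ₜ d q) = d q ⊗ₜ d q + (1 - (q ^ 2)⁻¹) • (c q ⊗ₜ b q) := by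
  have hq := NeZero.ne q
  refine ⟨?_, ?_, ?_, ?_, ?_, ?_, ?_, ?_, ?_, ?_, ?_, ?_, ?_, ?_, ?_, ?_⟩ <;>
  simp [ψ_tmul, L_a_tmul, L_b_tmul, L_c_tmul, L_d_tmul, sub_tmul, ← smul_tmul', smul_sub] <;>
  (match_scalars <;> field_simp <;> ring)

theorem braidingValues : BraidingValues q (ψ (q := q)) := by
  obtain ⟨aa, ab, ac, ad, ba, bb, bc, bd, ca, cb, cc, cd, da, db, dc, dd⟩ := ψ_generators (q := q)
  exact ⟨aa, ab, ac, ad, ba, bb, bc, bd, ca, cb, cc, cd, da, db, dc, dd⟩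

theorem involutionValues (hq : starRingEnd ℂ q = q) : InvolutionValues q (star hq) :=
  ⟨star_a hq, star_b hq, star_c hq, star_d hq⟩

end values

end Alg

end BSL

end

theorem mainTheorem1 (q : ℂ) (hq : q ≠ 0) :
    ∃ H : BraidedHopfAlgebra ℂ (BSL.B q),
      BSL.CoproductValues q H.comul ∧
      BSL.CounitValues q H.counit ∧
      BSL.AntipodeValues q H.S ∧
      BSL.BraidingValues q H.ψ ∧
      -- for real `q`, it is a braided Hopf `*`-algebra
      ((starRingEnd ℂ) q = q → ∃ st : BSL.B q →ₛₗ[starRingEnd ℂ] BSL.B q,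
        BSL.InvolutionValues q st ∧ IsBraidedInvolution H st) ∧
      -- it differs from the structure with the matrix coproduct
      H.comul (BSL.a q) ≠ BSL.a q ⊗ₜ[ℂ] BSL.a q + BSL.b q ⊗ₜ[ℂ] BSL.c q ∧
      (q ^ 2 ≠ 1 → H.ψ (BSL.a q ⊗ₜ[ℂ] BSL.a q) ≠
        BSL.a q ⊗ₜ[ℂ] BSL.a q + (1 - q ^ 2) • (BSL.b q ⊗ₜ[ℂ] BSL.c q)) := by
  have : NeZero q := ⟨hq⟩
  exact ⟨BSL.Alg.braidedHopfAlgebra q, BSL.Alg.coproductValues, BSL.Alg.counitValues,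
    BSL.Alg.antipodeValues, BSL.Alg.braidingValues,
    fun h ↦ ⟨BSL.Alg.star h, BSL.Alg.involutionValues h,
      BSL.Alg.isBraidedInvolution h⟩, BSL.Alg.comul_a_ne, BSL.Alg.ψ_a_tmul_a_ne⟩
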